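/- Let $r,q,a\in\mathbb R$, $\sigma>0$, $b>0$, $0\le R<1$, $0<T_1<T$ and $E\in\mathbb R$ be constants with $e^{-r(T-T_1)}R<E<e^{-r(T-T_1)}$. Put $V_b(t)=be^{-a(T-t)}$, $\beta=1-\frac{2(r-q-a)}{\sigma^2}$, $\kappa=r-q-a-\frac{\sigma^2}{2}$, \[N(x)=\frac1{\sqrt{2\pi}}\int_{-\infty}^x e^{-y^2/2}\,dy,\qquad N_2(a_1,a_2;\rho)=\frac{1}{2\pi\sqrt{1-\rho^2}}\int_{-\infty}^{a_1}\int_{-\infty}^{a_2}e^{-\frac{y_1^2-2\rho y_1y_2+y_2^2}{2(1-\rho^2)}}\,dy_2\,dy_1,\] \[d(V,t)=\frac{\ln\frac{V}{V_b(t)}+\kappa(T-t)}{\sigma\sqrt{T-t}},\qquad \tilde d(V,t)=\frac{\ln\frac{V_b(t)}{V}+\kappa(T-t)}{\sigma\sqrt{T-t}},\] and let \[B(V,t)=Re^{-r(T-t)}+(1-R)e^{-r(T-t)}\Big[N(d)-\Big(\tfrac{V}{V_b(t)}\Big)^{\beta}N(\tilde d)\Big]\] be the price of the defaultable zero coupon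 bond with face value $1$, maturity $T$, default barrier $V_b$ and default recovery $Re^{-r(T-t)}$. Then there is a unique $K\ge V_b(T_1)$ such that, for all $V>V_b(T_1)$, $B(V,T_1)<E$ if $V<K$ and $B(V,T_1)\ge E$ if $V\ge K$. For this $K$, consider the following problem for the price $P(V,t)$ of the call option on the bond with exercise price $E$ and maturity $T_1$ (the premium of the callable bond): \[\frac{\partial P}{\partial t}+\frac12\sigma^2V^2\frac{\partial^2P}{\partial V^2}+(r-q)V\frac{\partial P}{\partial V}-rP=0,\qquad V>V_b(t),\ 0\le t<T_1,\] \[P(V_b(t),t)=0,\qquad 0\le t<T_1,\] \[P(V,T_1)=\Big\{Re^{-r(T-T_1)}-E+(1-R)e^{-r(T-T_1)}\Big[N(d)-\Big(\tfrac{V}{V_b(T_1)}\Big)^{\beta}N(\tilde d)\Big]_{t=T_1}\Big\}\cdot 1\{V\ge K\},\qquad V>V_b(T_1),\] where the terminal value equals $(B(V,T_1)-E)^+$. This problem has a unique classical solution, that is, a solution that is continuous on $\{0\le t\le T_1,\ V\ge V_b(t)\}$, has continuous derivatives $P_t,P_V,P_{VV}$ on $\{0\le t<T_1,\ V>V_b(t)\}$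 (with $P_t$ one-sided at $t=0$), and grows at most polynomially in $V$, uniformly in $t$. For $0\le t<T_1$ and $V\ge V_b(t)$ it is given by \[\begin{aligned}P(V,t)={}&\big[Re^{-r(T-t)}-Ee^{-r(T_1-t)}\big]\Big[N(b_2)-\Big(\tfrac{V}{V_b(t)}\Big)^{\beta}N(\tilde b_2)\Big]\\&+(1-R)e^{-r(T-t)}\Big[N_2(d,b_2;\rho)-\Big(\tfrac{V}{V_b(t)}\Big)^{\beta}N_2(\tilde d,\tilde b_2;\rho)\\&\qquad+N_2(d,-b_5;-\rho)-\Big(\tfrac{V}{V_b(t)}\Big)^{\beta}N_2(\tilde d,-\tilde b_5;-\rho)\Big],\end{aligned}\] where $d=d(V,t)$, $\tilde d=\tilde d(V,t)$, $\rho=\sqrt{(T_1-t)/(T-t)}$ and \[b_2=\frac{\ln\frac VK+\big(r-q-\frac{\sigma^2}2\big)(T_1-t)}{\sigma\sqrt{T_1-t}},\qquad \tilde b_2=\frac{\ln\Big(\frac{V_b(T_1)}{K}\cdot\frac{V_b(t)}{V}\Big)+\kappa(T_1-t)}{\sigma\sqrt{T_1-t}},\] \[-b_5=\frac{\ln\Big(\frac{V_b(T_1)}{K}\cdot\frac{V_b(t)}{V}\Big)-\kappa(T_1-t)}{\sigma\sqrt{T_1-t}},\qquad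 -\tilde b_5=\frac{\ln\frac{Ve^{a(T-t)}}{Ke^{a(T-T_1)}}-\kappa(T_1-t)}{\sigma\sqrt{T_1-t}}.\] -/

import Mathlib

noncomputable section

namespace CreditBond

/-- The standard normal distribution function `N`. -/
def normalCDF (x : ℝ) : ℝ :=
  1 / Real.sqrt (2 * Real.pi) * ∫ y in Set.Iic x, Real.exp (-y ^ 2 / 2)

/-- The standard bivariate normal distribution function `N₂(a₁, a₂; ρ)` with correlation `ρ`. -/
def binormalCDF (a₁ a₂ ρ : ℝ) : ℝ :=
  1 / (2 * Real.pi * Real.sqrt (1 - ρ ^ 2)) *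
    ∫ y₁ in Set.Iic a₁, ∫ y₂ in Set.Iic a₂,
      Real.exp (-(y₁ ^ 2 - 2 * ρ * y₁ * y₂ + y₂ ^ 2) / (2 * (1 - ρ ^ 2)))

/-- The constants of the model: short rate `r`, dividend rate `q`, volatility `σ`, default barrier
parameters `a`, `b`, recovery rate `R`, bond maturity `T`, option maturity `T₁`, exercise
price `E`. -/
structure Model where
  r : ℝ
  q : ℝ
  σ : ℝ
  a : ℝ
  b : ℝ
  R : ℝ
  T : ℝ
  T₁ : ℝ
  E : ℝ

namespace Model

variable (M : Model)

/-- The default barrier `V_b(t)`. -/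
def barrier (t : ℝ) : ℝ := M.b * Real.exp (-M.a * (M.T - t))

/-- The exponent `1 - 2 (r - q - a) / σ²`. -/
def expo : ℝ := 1 - 2 * (M.r - M.q - M.a) / M.σ ^ 2

/-- The drift `r - q - a - σ² / 2`. -/
def drift : ℝ := M.r - M.q - M.a - M.σ ^ 2 / 2

/-- `d₁ = d`. -/
def d (V t : ℝ) : ℝ :=
  (Real.log (V / M.barrier t) + M.drift * (M.T - t)) / (M.σ * Real.sqrt (M.T - t))

/-- `d₂ = d̃`. -/
def dTilde (V t : ℝ) : ℝ :=
  (Real.log (M.barrier t / V) + M.drift * (M.T - t)) / (M.σ * Real.sqrt (M.T - t))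

/-- The survival probability `W(V, t)`. -/
def survival (V t : ℝ) : ℝ :=
  normalCDF (M.d V t) - (V / M.barrier t) ^ M.expo * normalCDF (M.dTilde V t)

/-- The price `B(V, t)` of the defaultable zero coupon bond (for `t < T`). -/
def bond (V t : ℝ) : ℝ :=
  M.R * Real.exp (-M.r * (M.T - t)) +
    M.survival V t * (1 - M.R) * Real.exp (-M.r * (M.T - t))

/-- `K` is the exercise boundary: at time `T₁` the bond is worth less than `E` below `K` and at
least `E` from `K` on. -/
def IsExerciseBoundary (K : ℝ) : Prop :=
  M.barrier M.T₁ ≤ K ∧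
    ∀ V, M.barrier M.T₁ < V → (V < K → M.bond V M.T₁ < M.E) ∧ (K ≤ V → M.E ≤ M.bond V M.T₁)

/-- The terminal value of the call, written with the indicator of `{V ≥ K}`. -/
def payoff (K V : ℝ) : ℝ :=
  (M.R * Real.exp (-M.r * (M.T - M.T₁)) - M.E) * (Set.Ici K).indicator 1 V +
    (1 - M.R) * Real.exp (-M.r * (M.T - M.T₁)) * normalCDF (M.d V M.T₁) *
      (Set.Ici K).indicator 1 V -
    (1 - M.R) * Real.exp (-M.r * (M.T - M.T₁)) * (V / M.barrier M.T₁) ^ M.expo *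
      normalCDF (M.dTilde V M.T₁) * (Set.Ici K).indicator 1 V

/-- The points `(V, t)` with `0 ≤ t < T₁`, `V > V_b(t)`, where the equation is posed. -/
def region : Set (ℝ × ℝ) := {z | 0 ≤ z.2 ∧ z.2 < M.T₁ ∧ M.barrier z.2 < z.1}

/-- The closed region `0 ≤ t ≤ T₁`, `V ≥ V_b(t)`. -/
def closedRegion : Set (ℝ × ℝ) := {z | 0 ≤ z.2 ∧ z.2 ≤ M.T₁ ∧ M.barrier z.2 ≤ z.1}

/-- `P` is a classical solution, of at most polynomial growth in `V`, of the terminal boundary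
value problem for the price of the call: `P` is continuous on the closed region, has continuous
derivatives `P_t`, `P_V`, `P_VV` where the equation is posed (`P_t` being one-sided at `t = 0`),
and satisfies the Black-Scholes equation, the boundary condition on the moving barrier and the
terminal condition. -/
structure IsCallSolution (K : ℝ) (P : ℝ → ℝ → ℝ) : Prop where
  continuousOn : ContinuousOn (fun z : ℝ × ℝ => P z.1 z.2) M.closedRegion
  growth : ∃ (C : ℝ) (m : ℕ), ∀ z ∈ M.closedRegion, |P z.1 z.2| ≤ C * (1 + z.1 ^ m)
  equation : ∃ Pt PV PVV : ℝ → ℝ → ℝ,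
    ContinuousOn (fun z : ℝ × ℝ => Pt z.1 z.2) M.region ∧
    ContinuousOn (fun z : ℝ × ℝ => PV z.1 z.2) M.region ∧
    ContinuousOn (fun z : ℝ × ℝ => PVV z.1 z.2) M.region ∧
    ∀ V t, (V, t) ∈ M.region →
      HasDerivWithinAt (fun s => P V s) (Pt V t) (Set.Icc 0 M.T₁) t ∧
      HasDerivAt (fun v => P v t) (PV V t) V ∧
      HasDerivAt (fun v => PV v t) (PVV V t) V ∧
      Pt V t + 1 / 2 * M.σ ^ 2 * V ^ 2 * PVV V t + (M.r - M.q) * V * PV V t - M.r * P V t = 0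
  boundary : ∀ t, 0 ≤ t → t < M.T₁ → P (M.barrier t) t = 0
  terminal : ∀ V, M.barrier M.T₁ < V → P V M.T₁ = M.payoff K V

/-- The correlation `ρ`. -/
def corr (t : ℝ) : ℝ := Real.sqrt ((M.T₁ - t) / (M.T - t))

/-- `b₂`. -/
def b2 (K V t : ℝ) : ℝ :=
  (Real.log (V / K) + (M.r - M.q - M.σ ^ 2 / 2) * (M.T₁ - t)) / (M.σ * Real.sqrt (M.T₁ - t))

/-- `b̃₂`. -/
def b2Tilde (K V t : ℝ) : ℝ :=
  (Real.log (M.barrier M.T₁ / K * (M.barrier t / V)) + M.drift * (M.T₁ - t)) /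
    (M.σ * Real.sqrt (M.T₁ - t))

/-- `b₅`. -/
def b5 (K V t : ℝ) : ℝ :=
  -((Real.log (M.barrier M.T₁ / K * (M.barrier t / V)) - M.drift * (M.T₁ - t)) /
    (M.σ * Real.sqrt (M.T₁ - t)))

/-- `b̃₅`. -/
def b5Tilde (K V t : ℝ) : ℝ :=
  -((Real.log (V * Real.exp (M.a * (M.T - t)) / (K * Real.exp (M.a * (M.T - M.T₁)))) -
      M.drift * (M.T₁ - t)) / (M.σ * Real.sqrt (M.T₁ - t)))

/-- The explicit price of the call on the defaultable bond, for `0 ≤ t < T₁`. -/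
def callPrice (K V t : ℝ) : ℝ :=
  (M.R * Real.exp (-M.r * (M.T - t)) - M.E * Real.exp (-M.r * (M.T₁ - t))) *
      (normalCDF (M.b2 K V t) - (V / M.barrier t) ^ M.expo * normalCDF (M.b2Tilde K V t)) +
    (1 - M.R) * Real.exp (-M.r * (M.T - t)) *
      (binormalCDF (M.d V t) (M.b2 K V t) (M.corr t) -
        (V / M.barrier t) ^ M.expo *
          binormalCDF (M.dTilde V t) (M.b2Tilde K V t) (M.corr t) +
        binormalCDF (M.d V t) (-M.b5 K V t) (-M.corr t) -
        (V / M.barrier t) ^ M.expo *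
          binormalCDF (M.dTilde V t) (-M.b5Tilde K V t) (-M.corr t))

end Model

end CreditBond

end

open MeasureTheory Set Filter Topology

namespace CreditBond

/-! ### The standard normal distribution function -/

/-! In the variables x = ln(V/V_b(t)), τ = T₁ - t the moving barrier becomes x = 0, and after
removal of the discount factor the equation reads U_τ = (σ²/2) U_xx + κ U_x with constant
coefficients. The bond price at T₁ becomes c₁ + c₂ s(x), where s is the probability that a Brownian
motion with drift κ started at x stays positive for a time T - T₁. On x ≥ 0 the function s increases
strictly from 0 to 1 (`strictMonoOn_survivalProb`, `tendsto_survivalProb_atTop`, both from Mills'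
inequality), so the bounds on E give one sign change k > 0, and K = V_b(T₁)eᵏ.

Existence is the method of images. Extended by zero to x < 0, the payoff is continuous and bounded;
its Gaussian mean U solves the equation (`isDriftHeatSolution_heatMean`). With β = -2κ/σ² the
function e^{βx}U(-x, τ) is again a solution (`IsDriftHeatSolution.sub_reflect`). The difference
vanishes at x = 0 and keeps the terminal value on x > 0 (`isCallSolution_killedPrice`).

Uniqueness is a maximum principle: εe^{c(T₁-t)}V^{n+1} dominates the discounted difference of two
solutions for every ε > 0 (`IsCallSolution.sub_le_mul`).

For the closed form, a Gaussian mean of N over a half-line is a value of N₂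
(`setIntegral_exp_mul_normalCDF`). The two terms of s, each taken at x and at -x, give the four N₂
terms (`killedPrice_eq_callPrice`). -/

lemma exp_neg_sq_div_two_eq : (fun y : ℝ => Real.exp (-y ^ 2 / 2)) =
    fun y => Real.exp (-(1 / 2) * y ^ 2) := by
  funext y; congr 1; ring

lemma integrable_exp_neg_sq_div_two : Integrable (fun y : ℝ => Real.exp (-y ^ 2 / 2)) := by
  rw [exp_neg_sq_div_two_eq]; exact integrable_exp_neg_mul_sq (by norm_num)

lemma integral_exp_neg_sq_div_two :
    ∫ y : ℝ, Real.exp (-y ^ 2 / 2) = Real.sqrt (2 * Real.pi) := by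
  rw [exp_neg_sq_div_two_eq, integral_gaussian]; congr 1; ring

lemma continuous_exp_neg_sq_div_two : Continuous (fun y : ℝ => Real.exp (-y ^ 2 / 2)) := by
  fun_prop

lemma sqrt_two_pi_pos : 0 < Real.sqrt (2 * Real.pi) := Real.sqrt_pos.2 (by positivity)

/-- The standard normal density. -/
noncomputable def normalDensity (x : ℝ) : ℝ :=
  1 / Real.sqrt (2 * Real.pi) * Real.exp (-x ^ 2 / 2)

lemma normalDensity_pos (x : ℝ) : 0 < normalDensity x := by
  have := sqrt_two_pi_pos
  unfold normalDensity; positivity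

lemma normalDensity_neg (x : ℝ) : normalDensity (-x) = normalDensity x := by
  simp [normalDensity]

lemma integral_Iic_add_Iic_neg (x : ℝ) :
    (∫ y in Iic x, Real.exp (-y ^ 2 / 2)) + ∫ y in Iic (-x), Real.exp (-y ^ 2 / 2)
      = Real.sqrt (2 * Real.pi) := by
  have h : ∫ y in Iic (-x), Real.exp (-y ^ 2 / 2) = ∫ y in Ioi x, Real.exp (-y ^ 2 / 2) := by
    have := integral_comp_neg_Iic (-x) (fun y : ℝ => Real.exp (-y ^ 2 / 2))
    simpa using this
  rw [h, intervalIntegral.integral_Iic_add_Ioi integrable_exp_neg_sq_div_two.integrableOn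
    integrable_exp_neg_sq_div_two.integrableOn, integral_exp_neg_sq_div_two]

lemma normalCDF_add_neg (x : ℝ) : normalCDF x + normalCDF (-x) = 1 := by
  unfold normalCDF
  rw [← mul_add, integral_Iic_add_Iic_neg]
  field_simp

lemma normalCDF_nonneg (x : ℝ) : 0 ≤ normalCDF x := by
  unfold normalCDF
  have : 0 ≤ ∫ y in Iic x, Real.exp (-y ^ 2 / 2) :=
    integral_nonneg fun y => (Real.exp_pos _).le
  positivity

lemma normalCDF_le_one (x : ℝ) : normalCDF x ≤ 1 := by
  linarith [normalCDF_add_neg x, normalCDF_nonneg (-x)]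

lemma hasDerivAt_normalCDF (x : ℝ) : HasDerivAt normalCDF (normalDensity x) x := by
  have h : normalCDF = fun x => 1 / Real.sqrt (2 * Real.pi) *
      ((∫ y in Iic (0 : ℝ), Real.exp (-y ^ 2 / 2)) + ∫ y in (0 : ℝ)..x, Real.exp (-y ^ 2 / 2)) := by
    funext x
    unfold normalCDF
    rw [← intervalIntegral.integral_Iic_sub_Iic integrable_exp_neg_sq_div_two.integrableOn
      integrable_exp_neg_sq_div_two.integrableOn]
    ring
  rw [h]
  exact ((intervalIntegral.integral_hasDerivAt_right
    (integrable_exp_neg_sq_div_two.intervalIntegrable)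
    (continuous_exp_neg_sq_div_two.stronglyMeasurableAtFilter _ _)
    continuous_exp_neg_sq_div_two.continuousAt).const_add _).const_mul _

lemma continuous_normalCDF : Continuous normalCDF :=
  continuous_iff_continuousAt.2 fun x => (hasDerivAt_normalCDF x).continuousAt

/-- Mills' inequality. -/
lemma mul_normalCDF_neg_le (z : ℝ) : z * normalCDF (-z) ≤ normalDensity z := by
  have hd : ∀ y ∈ Iic (-z), HasDerivAt (fun y : ℝ => Real.exp (-y ^ 2 / 2))
      (-y * Real.exp (-y ^ 2 / 2)) y := fun y _ => by
    have h1 : HasDerivAt (fun y : ℝ => -y ^ 2 / 2) (-y) y := by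
      have := ((hasDerivAt_pow 2 y).neg).div_const 2
      refine this.congr_deriv ?_
      simp only [Nat.cast_ofNat]; ring
    refine h1.exp.congr_deriv (by ring)
  have hint : IntegrableOn (fun y : ℝ => -y * Real.exp (-y ^ 2 / 2)) (Iic (-z)) := by
    have := (integrable_mul_exp_neg_mul_sq (b := 1 / 2) (by norm_num)).neg
    refine Integrable.integrableOn (this.congr (ae_of_all _ fun y => ?_))
    simp only [Pi.neg_apply]
    rw [show -(1 / 2) * y ^ 2 = -y ^ 2 / 2 by ring]; ring
  have hlim : Tendsto (fun y : ℝ => Real.exp (-y ^ 2 / 2)) atBot (𝓝 0) := by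
    refine Real.tendsto_exp_atBot.comp ?_
    have h1 : Tendsto (fun y : ℝ => (-y) ^ 2) atBot atTop :=
      (tendsto_pow_atTop two_ne_zero).comp tendsto_neg_atBot_atTop
    have := (tendsto_neg_atTop_atBot.comp (h1.atTop_div_const (by norm_num : (0 : ℝ) < 2)))
    refine this.congr fun y => ?_
    simp only [Function.comp]; ring
  have hI := integral_Iic_of_hasDerivAt_of_tendsto' hd hint hlim
  have hle : ∫ y in Iic (-z), z * Real.exp (-y ^ 2 / 2) ≤
      ∫ y in Iic (-z), -y * Real.exp (-y ^ 2 / 2) := by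
    refine setIntegral_mono_on (integrable_exp_neg_sq_div_two.const_mul z).integrableOn hint
      measurableSet_Iic fun y hy => ?_
    have : z ≤ -y := by linarith [mem_Iic.1 hy]
    exact mul_le_mul_of_nonneg_right this (Real.exp_pos _).le
  rw [hI, integral_const_mul] at hle
  have hs := sqrt_two_pi_pos
  unfold normalCDF normalDensity
  calc _ = 1 / Real.sqrt (2 * Real.pi) * (z * ∫ y in Iic (-z), Real.exp (-y ^ 2 / 2)) := by ring
    _ ≤ _ := by
      refine mul_le_mul_of_nonneg_left ?_ (by positivity)
      simpa using hle

section

/-! ### Survival probability in the logarithmic variable -/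

/-- The probability that a Brownian motion with drift `κ` and volatility `σ`, started at `x`, stays
positive up to time `θ`. -/
noncomputable def survivalProb (κ σ θ x : ℝ) : ℝ :=
  normalCDF ((x + κ * θ) / (σ * Real.sqrt θ)) -
    Real.exp (-2 * κ / σ ^ 2 * x) * normalCDF ((-x + κ * θ) / (σ * Real.sqrt θ))

variable {κ σ θ : ℝ}

lemma survivalProb_zero : survivalProb κ σ θ 0 = 0 := by simp [survivalProb]

lemma survivalProb_le_one (x : ℝ) : survivalProb κ σ θ x ≤ 1 := by
  have := mul_nonneg (Real.exp_pos (-2 * κ / σ ^ 2 * x)).le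
    (normalCDF_nonneg ((-x + κ * θ) / (σ * Real.sqrt θ)))
  unfold survivalProb
  linarith [normalCDF_le_one ((x + κ * θ) / (σ * Real.sqrt θ))]

lemma continuous_survivalProb : Continuous (survivalProb κ σ θ) := by
  have := continuous_normalCDF
  unfold survivalProb
  fun_prop

/-- The squares (x + κθ)² and (-x + κθ)² differ by 4κθx, which the weight absorbs exactly. This
merges the two density terms of the derivative and controls the weighted tail at infinity even when
the weight grows. -/
lemma exp_mul_normalDensity_reflect (hσ : 0 < σ) (hθ : 0 < θ) (x : ℝ) :
    Real.exp (-2 * κ / σ ^ 2 * x) * normalDensity ((-x + κ * θ) / (σ * Real.sqrt θ)) =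
      normalDensity ((x + κ * θ) / (σ * Real.sqrt θ)) := by
  unfold normalDensity
  rw [mul_left_comm, ← Real.exp_add]
  congr 2
  rw [div_pow, div_pow, mul_pow, Real.sq_sqrt hθ.le]
  field_simp
  ring

lemma hasDerivAt_survivalProb (hσ : 0 < σ) (hθ : 0 < θ) (x : ℝ) :
    HasDerivAt (survivalProb κ σ θ)
      (Real.exp (-2 * κ / σ ^ 2 * x) *
        (2 * normalDensity ((-x + κ * θ) / (σ * Real.sqrt θ)) / (σ * Real.sqrt θ) +
          2 * κ / σ ^ 2 * normalCDF ((-x + κ * θ) / (σ * Real.sqrt θ)))) x := by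
  have h1 : HasDerivAt (fun x : ℝ => (x + κ * θ) / (σ * Real.sqrt θ)) (1 / (σ * Real.sqrt θ)) x :=
    ((hasDerivAt_id x).add_const _).div_const _
  have h2 : HasDerivAt (fun x : ℝ => (-x + κ * θ) / (σ * Real.sqrt θ)) (-1 / (σ * Real.sqrt θ)) x :=
    ((hasDerivAt_id x).neg.add_const _).div_const _
  have h3 : HasDerivAt (fun x : ℝ => Real.exp (-2 * κ / σ ^ 2 * x))
      (Real.exp (-2 * κ / σ ^ 2 * x) * (-2 * κ / σ ^ 2 * 1)) x :=
    ((hasDerivAt_id x).const_mul (-2 * κ / σ ^ 2)).exp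
  have h := ((hasDerivAt_normalCDF _).comp x h1).sub
    (h3.mul ((hasDerivAt_normalCDF _).comp x h2))
  refine h.congr_deriv ?_
  rw [← exp_mul_normalDensity_reflect hσ hθ]
  simp only [Function.comp]
  ring

/-- The derivative is a positive weight times φ-term plus κ·N-term. Only κ < 0 is in doubt; there
Mills' inequality at z = (x - κθ)/(σ√θ) bounds the negative term, and the surplus xN gives
strictness. -/
lemma strictMonoOn_survivalProb (hσ : 0 < σ) (hθ : 0 < θ) :
    StrictMonoOn (survivalProb κ σ θ) (Ici 0) := by
  refine strictMonoOn_of_deriv_pos (convex_Ici 0) continuous_survivalProb.continuousOn ?_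
  intro x hx
  rw [interior_Ici, mem_Ioi] at hx
  rw [(hasDerivAt_survivalProb hσ hθ x).deriv]
  refine mul_pos (Real.exp_pos _) ?_
  have hs : 0 < Real.sqrt θ := Real.sqrt_pos.2 hθ
  set D := normalDensity ((-x + κ * θ) / (σ * Real.sqrt θ)) with hD
  set N := normalCDF ((-x + κ * θ) / (σ * Real.sqrt θ)) with hN
  have hDp : 0 < D := normalDensity_pos _
  have hN0 : 0 ≤ N := normalCDF_nonneg _
  rcases le_or_gt 0 κ with hκ | hκ
  · positivity
  · have hz : 0 < (x - κ * θ) / (σ * Real.sqrt θ) := by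
      have : κ * θ < 0 := mul_neg_of_neg_of_pos hκ hθ
      have : 0 < x - κ * θ := by linarith
      positivity
    have hm := mul_normalCDF_neg_le ((x - κ * θ) / (σ * Real.sqrt θ))
    have e : -((x - κ * θ) / (σ * Real.sqrt θ)) = (-x + κ * θ) / (σ * Real.sqrt θ) := by ring
    rw [← normalDensity_neg, e, ← hN, ← hD, div_mul_eq_mul_div, div_le_iff₀ (by positivity)] at hm
    have hx2 : 0 ≤ x * N := by positivity
    have h4 : -(κ * θ) * N ≤ D * (σ * Real.sqrt θ) := by nlinarith
    have h5 : 0 < D * (σ * Real.sqrt θ) := by positivity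
    have key : 2 * D / (σ * Real.sqrt θ) + 2 * κ / σ ^ 2 * N =
        2 * (D * (σ * Real.sqrt θ) + κ * θ * N) / (σ ^ 2 * θ) := by
      have hq : θ = Real.sqrt θ ^ 2 := (Real.sq_sqrt hθ.le).symm
      rw [eq_div_iff (by positivity)]
      field_simp
      have e2 : Real.sqrt θ ^ 2 = θ := Real.sq_sqrt hθ.le
      nlinarith [e2]
    rw [key]
    refine div_pos ?_ (by positivity)
    -- Only N ≥ 0 is at hand: if N = 0 the density term alone is positive, otherwise xN > 0 is the
    -- slack.
    rcases eq_or_lt_of_le hN0 with h0 | h0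
    · rw [← h0]; nlinarith
    · have : 0 < x * N := by positivity
      nlinarith

lemma tendsto_normalDensity_atTop : Tendsto normalDensity atTop (𝓝 0) := by
  have : Tendsto (fun y : ℝ => Real.exp (-y ^ 2 / 2)) atTop (𝓝 0) := by
    refine Real.tendsto_exp_atBot.comp ?_
    have h1 : Tendsto (fun y : ℝ => y ^ 2) atTop atTop := tendsto_pow_atTop two_ne_zero
    have := (tendsto_neg_atTop_atBot.comp (h1.atTop_div_const (by norm_num : (0 : ℝ) < 2)))
    refine this.congr fun y => ?_
    simp only [Function.comp]; ring
  have h := this.const_mul (1 / Real.sqrt (2 * Real.pi))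
  rwa [mul_zero] at h

/-- For z ≥ 1 Mills' inequality gives N(-z) ≤ φ(z). By the reflection identity both losses, 1 - N
and the weighted tail, are then at most the same density, so s is squeezed between 1 - 2φ and 1. -/
lemma tendsto_survivalProb_atTop (hσ : 0 < σ) (hθ : 0 < θ) :
    Tendsto (survivalProb κ σ θ) atTop (𝓝 1) := by
  have hs : 0 < σ * Real.sqrt θ := mul_pos hσ (Real.sqrt_pos.2 hθ)
  have hd : Tendsto (fun x : ℝ => (x + κ * θ) / (σ * Real.sqrt θ)) atTop atTop :=
    (tendsto_atTop_add_const_right _ _ tendsto_id).atTop_div_const hs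
  have hd' : Tendsto (fun x : ℝ => (x - κ * θ) / (σ * Real.sqrt θ)) atTop atTop :=
    (tendsto_atTop_add_const_right _ (-(κ * θ)) tendsto_id).atTop_div_const hs
  have hlow : Tendsto (fun x : ℝ => 1 - 2 * normalDensity ((x + κ * θ) / (σ * Real.sqrt θ)))
      atTop (𝓝 1) := by
    simpa using ((tendsto_normalDensity_atTop.comp hd).const_mul 2).const_sub 1
  refine tendsto_of_tendsto_of_tendsto_of_le_of_le' hlow tendsto_const_nhds ?_
    (Eventually.of_forall survivalProb_le_one)
  filter_upwards [hd.eventually_ge_atTop 1, hd'.eventually_ge_atTop 1] with x h1 h2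
  have hmills : ∀ z : ℝ, 1 ≤ z → normalCDF (-z) ≤ normalDensity z := fun z hz => by
    have := mul_normalCDF_neg_le z
    nlinarith [normalCDF_nonneg (-z)]
  have a1 := hmills _ h1
  have a2 := hmills _ h2
  have e : -((x - κ * θ) / (σ * Real.sqrt θ)) = (-x + κ * θ) / (σ * Real.sqrt θ) := by ring
  rw [← normalDensity_neg, e] at a2
  have a3 := mul_le_mul_of_nonneg_left a2 (Real.exp_pos (-2 * κ / σ ^ 2 * x)).le
  rw [exp_mul_normalDensity_reflect hσ hθ] at a3
  have a4 := normalCDF_add_neg ((x + κ * θ) / (σ * Real.sqrt θ))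
  unfold survivalProb
  linarith

end

section

/-! ### Gaussian moments as functions of the exponent -/

/-- The power is absorbed by n!·e^{|y|}, and the resulting linear exponent by half of the quadratic
decay, on completing the square. These functions are the dominating bounds for differentiation under
the integral. -/
lemma integrable_abs_pow_mul_exp {p : ℝ} (hp : 0 < p) (A : ℝ) (n : ℕ) :
    Integrable (fun y : ℝ => |y| ^ n * Real.exp (-p * y ^ 2 + A * |y|)) := by
  have hb : Integrable (fun y : ℝ => n.factorial * Real.exp ((A + 1) ^ 2 / (2 * p)) *
      Real.exp (-(p / 2) * y ^ 2)) := (integrable_exp_neg_mul_sq (by positivity)).const_mul _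
  refine hb.mono' (by fun_prop) (ae_of_all _ fun y => ?_)
  rw [Real.norm_of_nonneg (by positivity)]
  have h1 : |y| ^ n ≤ n.factorial * Real.exp |y| := by
    have := Real.pow_div_factorial_le_exp |y| (abs_nonneg y) n
    rwa [div_le_iff₀ (by positivity), mul_comm] at this
  calc |y| ^ n * Real.exp (-p * y ^ 2 + A * |y|)
      ≤ n.factorial * Real.exp |y| * Real.exp (-p * y ^ 2 + A * |y|) := by gcongr
    _ = n.factorial * Real.exp (|y| + (-p * y ^ 2 + A * |y|)) := by rw [Real.exp_add |y|]; ring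
    _ ≤ n.factorial * Real.exp ((A + 1) ^ 2 / (2 * p) + -(p / 2) * y ^ 2) := by
        refine mul_le_mul_of_nonneg_left (Real.exp_le_exp.2 ?_) (by positivity)
        have : 0 ≤ (p * |y| - (A + 1)) ^ 2 / (2 * p) := by positivity
        have e : (p * |y| - (A + 1)) ^ 2 / (2 * p) =
            p / 2 * |y| ^ 2 - (A + 1) * |y| + (A + 1) ^ 2 / (2 * p) := by field_simp; ring
        rw [e, sq_abs] at this
        linarith
    _ = _ := by rw [Real.exp_add]; ring

/-- The moments of `f` against the Gaussian weight `exp (-p y² + α y)`, where `z = (p, α)`. -/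
noncomputable def gaussMoment (f : ℝ → ℝ) (n : ℕ) (z : ℝ × ℝ) : ℝ :=
  ∫ y, f y * y ^ n * Real.exp (-z.1 * y ^ 2 + z.2 * y)

variable {f : ℝ → ℝ} {C : ℝ}

lemma abs_gaussMoment_integrand_le (hC : ∀ y, |f y| ≤ C) (n : ℕ) {p A : ℝ} {z : ℝ × ℝ}
    (hp : p ≤ z.1) (hA : |z.2| ≤ A) (y : ℝ) :
    |f y * y ^ n * Real.exp (-z.1 * y ^ 2 + z.2 * y)| ≤
      C * (|y| ^ n * Real.exp (-p * y ^ 2 + A * |y|)) := by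
  rw [abs_mul, abs_mul, abs_pow, Real.abs_exp, mul_assoc]
  have h1 : z.2 * y ≤ A * |y| := by
    calc z.2 * y ≤ |z.2| * |y| := by rw [← abs_mul]; exact le_abs_self _
      _ ≤ _ := by gcongr
  have hC0 : 0 ≤ C := (abs_nonneg _).trans (hC y)
  gcongr
  exact hC y

lemma integrable_gaussMoment_integrand (hf : Continuous f) (hC : ∀ y, |f y| ≤ C) (n : ℕ)
    {z : ℝ × ℝ} (hz : 0 < z.1) :
    Integrable (fun y => f y * y ^ n * Real.exp (-z.1 * y ^ 2 + z.2 * y)) :=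
  ((integrable_abs_pow_mul_exp hz |z.2| n).const_mul C).mono'
    (by fun_prop) (ae_of_all _ fun y => abs_gaussMoment_integrand_le hC n le_rfl le_rfl y)

/-- Differentiating the weight in p brings down -y² and in α brings down y, so the family of moments
is closed under differentiation. Dominated differentiation applies on p > z.1/2, |α| < |z.2| + 1.
The joint Fréchet form yields continuity and the chain rule along any curve. -/
lemma hasFDerivAt_gaussMoment (hf : Continuous f) (hC : ∀ y, |f y| ≤ C) (n : ℕ)
    {z : ℝ × ℝ} (hz : 0 < z.1) :
    HasFDerivAt (gaussMoment f n)
      ((-gaussMoment f (n + 2) z) • ContinuousLinearMap.fst ℝ ℝ ℝ +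
        gaussMoment f (n + 1) z • ContinuousLinearMap.snd ℝ ℝ ℝ) z := by
  set F' : ℝ × ℝ → ℝ → (ℝ × ℝ →L[ℝ] ℝ) := fun z y =>
    (-(f y * y ^ (n + 2) * Real.exp (-z.1 * y ^ 2 + z.2 * y))) • ContinuousLinearMap.fst ℝ ℝ ℝ +
      (f y * y ^ (n + 1) * Real.exp (-z.1 * y ^ 2 + z.2 * y)) • ContinuousLinearMap.snd ℝ ℝ ℝ
    with hF'
  have hp : 0 < z.1 / 2 := by positivity
  have hs : {w : ℝ × ℝ | z.1 / 2 < w.1 ∧ |w.2| < |z.2| + 1} ∈ 𝓝 z := by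
    refine IsOpen.mem_nhds ?_ ⟨by linarith, by linarith⟩
    exact (isOpen_lt continuous_const continuous_fst).inter
      (isOpen_lt continuous_snd.abs continuous_const)
  have key := hasFDerivAt_integral_of_dominated_of_fderiv_le (𝕜 := ℝ) (μ := volume)
    (F := fun (z : ℝ × ℝ) y => f y * y ^ n * Real.exp (-z.1 * y ^ 2 + z.2 * y)) (F' := F')
    (x₀ := z) (bound := fun y => C * (|y| ^ (n + 2) *
      Real.exp (-(z.1 / 2) * y ^ 2 + (|z.2| + 1) * |y|)) +
      C * (|y| ^ (n + 1) * Real.exp (-(z.1 / 2) * y ^ 2 + (|z.2| + 1) * |y|))) hs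
    (Eventually.of_forall fun w => by fun_prop)
    (integrable_gaussMoment_integrand hf hC n hz)
    (by
      refine Continuous.aestronglyMeasurable ?_
      simp only [hF']
      fun_prop)
    (ae_of_all _ fun y w hw => by
      refine (norm_add_le _ _).trans (add_le_add ?_ ?_)
      · rw [norm_smul, norm_neg]
        exact (mul_le_of_le_one_right (norm_nonneg _) (ContinuousLinearMap.norm_fst_le ℝ ℝ ℝ)).trans
          (abs_gaussMoment_integrand_le hC _ hw.1.le hw.2.le y)
      · rw [norm_smul]
        exact (mul_le_of_le_one_right (norm_nonneg _) (ContinuousLinearMap.norm_snd_le ℝ ℝ ℝ)).trans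
          (abs_gaussMoment_integrand_le hC _ hw.1.le hw.2.le y))
    (((integrable_abs_pow_mul_exp hp (|z.2| + 1) (n + 2)).const_mul C).add
      ((integrable_abs_pow_mul_exp hp (|z.2| + 1) (n + 1)).const_mul C))
    (ae_of_all _ fun y w _ => by
      have h1 : HasFDerivAt (fun z : ℝ × ℝ => -z.1 * y ^ 2 + z.2 * y)
          ((-(y ^ 2)) • ContinuousLinearMap.fst ℝ ℝ ℝ + y • ContinuousLinearMap.snd ℝ ℝ ℝ) w := by
        have := (((ContinuousLinearMap.fst ℝ ℝ ℝ).hasFDerivAt (x := w)).neg.mul_const (y ^ 2)).add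
          (((ContinuousLinearMap.snd ℝ ℝ ℝ).hasFDerivAt (x := w)).mul_const y)
        refine this.congr_fderiv ?_
        ext <;> simp
      refine (h1.exp.const_mul (f y * y ^ n)).congr_fderiv ?_
      ext <;> simp [hF'] <;> ring)
  refine key.congr_fderiv ?_
  simp only [hF']
  rw [integral_add, integral_smul_const, integral_smul_const, integral_neg]
  · rfl
  · exact ((integrable_gaussMoment_integrand hf hC (n + 2) hz).neg).smul_const _
  · exact (integrable_gaussMoment_integrand hf hC (n + 1) hz).smul_const _

lemma hasDerivAt_gaussMoment_comp (hf : Continuous f) (hC : ∀ y, |f y| ≤ C) (n : ℕ)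
    {p α : ℝ → ℝ} {p' α' t : ℝ} (hp : HasDerivAt p p' t) (hα : HasDerivAt α α' t)
    (h0 : 0 < p t) :
    HasDerivAt (fun t => gaussMoment f n (p t, α t))
      (-gaussMoment f (n + 2) (p t, α t) * p' + gaussMoment f (n + 1) (p t, α t) * α') t := by
  have := (hasFDerivAt_gaussMoment hf hC n (z := (p t, α t)) h0).comp_hasDerivAt t (hp.prodMk hα)
  refine this.congr_deriv ?_
  simp

lemma continuousOn_gaussMoment (hf : Continuous f) (hC : ∀ y, |f y| ≤ C) (n : ℕ) :
    ContinuousOn (gaussMoment f n) {z | 0 < z.1} := fun _ hz =>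
  (hasFDerivAt_gaussMoment hf hC n hz).continuousAt.continuousWithinAt

/-! ### The heat equation with drift -/

/-- `U` is a classical solution of `U_τ = σ² / 2 U_xx + κ U_x` for `τ > 0`, with continuous
derivatives `Ux`, `Uxx`; differentiability of `U` is expressed along curves. -/
structure IsDriftHeatSolution (κ σ : ℝ) (U Ux Uxx : ℝ → ℝ → ℝ) : Prop where
  curve : ∀ (X S : ℝ → ℝ) (X' S' t : ℝ), HasDerivAt X X' t → HasDerivAt S S' t → 0 < S t →
    HasDerivAt (fun t => U (X t) (S t)) (Ux (X t) (S t) * X' +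
      (σ ^ 2 / 2 * Uxx (X t) (S t) + κ * Ux (X t) (S t)) * S') t
  deriv_x : ∀ x τ, 0 < τ → HasDerivAt (fun x => Ux x τ) (Uxx x τ) x
  cont : ContinuousOn (fun z : ℝ × ℝ => U z.1 z.2) {z | 0 < z.2}
  cont_x : ContinuousOn (fun z : ℝ × ℝ => Ux z.1 z.2) {z | 0 < z.2}
  cont_xx : ContinuousOn (fun z : ℝ × ℝ => Uxx z.1 z.2) {z | 0 < z.2}

variable {κ σ : ℝ} {U Ux Uxx : ℝ → ℝ → ℝ}

lemma IsDriftHeatSolution.deriv_U (h : IsDriftHeatSolution κ σ U Ux Uxx) {x τ : ℝ} (hτ : 0 < τ) :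
    HasDerivAt (fun x => U x τ) (Ux x τ) x := by
  have := h.curve id (fun _ => τ) 1 0 x (hasDerivAt_id x) (hasDerivAt_const x τ) hτ
  simpa using this

/-- Reflection at the origin, with the weight that makes up for the drift. -/
lemma IsDriftHeatSolution.sub_reflect (h : IsDriftHeatSolution κ σ U Ux Uxx) {β : ℝ}
    (hβ : σ ^ 2 * β = -2 * κ) :
    IsDriftHeatSolution κ σ (fun x τ => U x τ - Real.exp (β * x) * U (-x) τ)
      (fun x τ => Ux x τ - Real.exp (β * x) * (β * U (-x) τ - Ux (-x) τ))
      (fun x τ => Uxx x τ -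
        Real.exp (β * x) * (β ^ 2 * U (-x) τ - 2 * β * Ux (-x) τ + Uxx (-x) τ)) where
  curve X S X' S' t hX hS h0 := by
    have h1 := h.curve X S X' S' t hX hS h0
    have h2 := h.curve (fun t => -X t) S (-X') S' t hX.neg hS h0
    refine (h1.sub ((hX.const_mul β).exp.mul h2)).congr_deriv ?_
    -- This β is the one for which conjugation by e^{βx} undoes the change of sign of the drift
    -- under x ↦ -x and leaves no zeroth-order term.
    have hκ : κ = -(σ ^ 2 * β) / 2 := by linarith
    rw [hκ]; ring
  deriv_x x τ hτ := by
    have hn : HasDerivAt (fun x : ℝ => -x) (-1) x := (hasDerivAt_id x).neg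
    have h1 := h.deriv_x x τ hτ
    have h2 := HasDerivAt.comp x (h.deriv_U (x := -x) hτ) hn
    have h3 := HasDerivAt.comp x (h.deriv_x (-x) τ hτ) hn
    have he := ((hasDerivAt_id x).const_mul β).exp
    refine (h1.sub (he.mul ((h2.const_mul β).sub h3))).congr_deriv ?_
    simp only [Pi.sub_apply, Function.comp, id]
    ring
  cont := by
    have hr : ContinuousOn (fun z : ℝ × ℝ => U (-z.1) z.2) {z | 0 < z.2} :=
      h.cont.comp (f := fun z : ℝ × ℝ => (-z.1, z.2)) (by fun_prop) (fun z hz => hz)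
    exact h.cont.sub (ContinuousOn.mul (by fun_prop) hr)
  cont_x := by
    have hr : ContinuousOn (fun z : ℝ × ℝ => U (-z.1) z.2) {z | 0 < z.2} :=
      h.cont.comp (f := fun z : ℝ × ℝ => (-z.1, z.2)) (by fun_prop) (fun z hz => hz)
    have hrx : ContinuousOn (fun z : ℝ × ℝ => Ux (-z.1) z.2) {z | 0 < z.2} :=
      h.cont_x.comp (f := fun z : ℝ × ℝ => (-z.1, z.2)) (by fun_prop) (fun z hz => hz)
    exact h.cont_x.sub (ContinuousOn.mul (by fun_prop) ((hr.const_mul β).sub hrx))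
  cont_xx := by
    have hr : ContinuousOn (fun z : ℝ × ℝ => U (-z.1) z.2) {z | 0 < z.2} :=
      h.cont.comp (f := fun z : ℝ × ℝ => (-z.1, z.2)) (by fun_prop) (fun z hz => hz)
    have hrx : ContinuousOn (fun z : ℝ × ℝ => Ux (-z.1) z.2) {z | 0 < z.2} :=
      h.cont_x.comp (f := fun z : ℝ × ℝ => (-z.1, z.2)) (by fun_prop) (fun z hz => hz)
    have hrxx : ContinuousOn (fun z : ℝ × ℝ => Uxx (-z.1) z.2) {z | 0 < z.2} :=
      h.cont_xx.comp (f := fun z : ℝ × ℝ => (-z.1, z.2)) (by fun_prop) (fun z hz => hz)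
    exact h.cont_xx.sub (ContinuousOn.mul (by fun_prop)
      (((hr.const_mul _).sub (hrx.const_mul _)).add hrxx))

/-- The mean of `f` at time `τ` along a Brownian motion with drift `κ` and volatility `σ`. -/
noncomputable def heatMean (κ σ : ℝ) (f : ℝ → ℝ) (x τ : ℝ) : ℝ :=
  1 / Real.sqrt (2 * Real.pi) *
    ∫ z, f (x + κ * τ + σ * Real.sqrt τ * z) * Real.exp (-z ^ 2 / 2)

lemma heatMean_zero (x : ℝ) : heatMean κ σ f x 0 = f x := by
  have := sqrt_two_pi_pos
  simp only [heatMean, Real.sqrt_zero, mul_zero, zero_mul, add_zero]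
  rw [integral_const_mul, integral_exp_neg_sq_div_two]
  field_simp

lemma abs_heatMean_le (hC : ∀ y, |f y| ≤ C) (x τ : ℝ) :
    |heatMean κ σ f x τ| ≤ C := by
  have hs := sqrt_two_pi_pos
  have h1 : ‖∫ z, f (x + κ * τ + σ * Real.sqrt τ * z) * Real.exp (-z ^ 2 / 2)‖ ≤
      ∫ z : ℝ, C * Real.exp (-z ^ 2 / 2) := by
    refine norm_integral_le_of_norm_le (integrable_exp_neg_sq_div_two.const_mul C)
      (ae_of_all _ fun z => ?_)
    rw [norm_mul, Real.norm_of_nonneg (Real.exp_pos _).le]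
    exact mul_le_mul_of_nonneg_right (hC _) (Real.exp_pos _).le
  rw [integral_const_mul, integral_exp_neg_sq_div_two, Real.norm_eq_abs] at h1
  rw [heatMean, abs_mul, abs_of_pos (by positivity : 0 < 1 / Real.sqrt (2 * Real.pi)),
    div_mul_eq_mul_div, one_mul, div_le_iff₀ hs]
  exact h1

/-- With τ inside the argument of `f` and not in the kernel, dominated convergence includes τ = 0.
This is how the terminal value is attained continuously. -/
lemma continuous_heatMean (hf : Continuous f) (hC : ∀ y, |f y| ≤ C) :
    Continuous (fun z : ℝ × ℝ => heatMean κ σ f z.1 z.2) := by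
  unfold heatMean
  refine continuous_const.mul (continuous_of_dominated
    (bound := fun z => C * Real.exp (-z ^ 2 / 2)) (fun w => by fun_prop) (fun w => ?_)
    (integrable_exp_neg_sq_div_two.const_mul C) (ae_of_all _ fun z => by fun_prop))
  refine ae_of_all _ fun z => ?_
  rw [norm_mul, Real.norm_of_nonneg (Real.exp_pos _).le]
  exact mul_le_mul_of_nonneg_right (hC _) (Real.exp_pos _).le

/-- The factor in front of the Gaussian moments. -/
noncomputable def heatFactor (κ σ x τ : ℝ) : ℝ :=
  1 / (Real.sqrt (2 * Real.pi) * σ) *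
    Real.exp (-(x + κ * τ) ^ 2 / (2 * (σ ^ 2 * τ)) - Real.log τ / 2)

/-- Gaussian moments in the heat variables. -/
noncomputable def heatMoment (κ σ : ℝ) (f : ℝ → ℝ) (n : ℕ) (x τ : ℝ) : ℝ :=
  gaussMoment f n (1 / (2 * (σ ^ 2 * τ)), (x + κ * τ) / (σ ^ 2 * τ))

/-- The substitution y = x + κτ + σ√τ z moves x and τ into the kernel, so that derivatives no longer
fall on `f`, which is merely continuous. Expanding the square splits off the factor independent of
y. -/
lemma heatMean_eq (hσ : 0 < σ) {x τ : ℝ} (hτ : 0 < τ) :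
    heatMean κ σ f x τ = heatFactor κ σ x τ * heatMoment κ σ f 0 x τ := by
  have hs : 0 < σ * Real.sqrt τ := mul_pos hσ (Real.sqrt_pos.2 hτ)
  have h2 := sqrt_two_pi_pos
  have hq : Real.sqrt τ ^ 2 = τ := Real.sq_sqrt hτ.le
  have hlog : Real.exp (-(Real.log τ / 2)) = 1 / Real.sqrt τ := by
    rw [Real.exp_neg, ← Real.log_sqrt hτ.le, Real.exp_log (Real.sqrt_pos.2 hτ), one_div]
  set m := x + κ * τ with hm
  have e1 := Measure.integral_comp_mul_left
    (fun y => f (m + y) * Real.exp (-(y / (σ * Real.sqrt τ)) ^ 2 / 2)) (σ * Real.sqrt τ)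
  have e2 := integral_add_left_eq_self (μ := volume)
    (fun y => f y * Real.exp (-((y - m) / (σ * Real.sqrt τ)) ^ 2 / 2)) m
  have e3 : ∀ z : ℝ, f (m + σ * Real.sqrt τ * z) *
      Real.exp (-(σ * Real.sqrt τ * z / (σ * Real.sqrt τ)) ^ 2 / 2) =
      f (m + σ * Real.sqrt τ * z) * Real.exp (-z ^ 2 / 2) := fun z => by
    rw [mul_div_cancel_left₀ _ hs.ne']
  simp only [e3] at e1
  simp only [add_sub_cancel_left] at e2
  rw [heatMean, ← hm, e1, e2, heatFactor, heatMoment, gaussMoment, ← hm, sub_eq_add_neg,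
    Real.exp_add, hlog, abs_of_pos (by positivity), smul_eq_mul]
  have e4 : ∀ y : ℝ, f y * Real.exp (-((y - m) / (σ * Real.sqrt τ)) ^ 2 / 2) =
      Real.exp (-m ^ 2 / (2 * (σ ^ 2 * τ))) * (f y * y ^ 0 *
        Real.exp (-(1 / (2 * (σ ^ 2 * τ))) * y ^ 2 + m / (σ ^ 2 * τ) * y)) := fun y => by
    rw [mul_left_comm, ← Real.exp_add, pow_zero, mul_one, div_pow, mul_pow, hq]
    congr 2
    field_simp
    ring
  simp only [e4]
  rw [integral_const_mul]
  field_simp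

lemma hasDerivAt_heatFactor (hσ : 0 < σ) {X S : ℝ → ℝ} {X' S' t : ℝ} (hX : HasDerivAt X X' t)
    (hS : HasDerivAt S S' t) (h0 : 0 < S t) :
    HasDerivAt (fun t => heatFactor κ σ (X t) (S t)) (heatFactor κ σ (X t) (S t) *
      (-(X t + κ * S t) * (X' + κ * S') / (σ ^ 2 * S t) +
        (X t + κ * S t) ^ 2 * S' / (2 * σ ^ 2 * S t ^ 2) - S' / (2 * S t))) t := by
  have h1 := ((hX.add (hS.const_mul κ)).pow 2).neg.div ((hS.const_mul (σ ^ 2)).const_mul 2)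
    (by positivity)
  have h2 := (hS.log h0.ne').div_const 2
  refine ((h1.sub h2).exp.const_mul (1 / (Real.sqrt (2 * Real.pi) * σ))).congr_deriv ?_
  simp only [heatFactor, Pi.add_apply, Pi.pow_apply, Pi.neg_apply, Pi.sub_apply, Pi.div_apply]
  rw [← mul_assoc]
  congr 1
  field_simp
  push_cast
  ring

lemma hasDerivAt_heatMoment (hf : Continuous f) (hC : ∀ y, |f y| ≤ C) (hσ : 0 < σ) (n : ℕ)
    {X S : ℝ → ℝ} {X' S' t : ℝ} (hX : HasDerivAt X X' t) (hS : HasDerivAt S S' t) (h0 : 0 < S t) :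
    HasDerivAt (fun t => heatMoment κ σ f n (X t) (S t))
      (heatMoment κ σ f (n + 2) (X t) (S t) * (S' / (2 * σ ^ 2 * S t ^ 2)) +
        heatMoment κ σ f (n + 1) (X t) (S t) *
          ((X' + κ * S') / (σ ^ 2 * S t) - (X t + κ * S t) * S' / (σ ^ 2 * S t ^ 2))) t := by
  have h1 := (hasDerivAt_const t (1 : ℝ)).div ((hS.const_mul (σ ^ 2)).const_mul 2) (by positivity)
  have h2 := (hX.add (hS.const_mul κ)).div (hS.const_mul (σ ^ 2)) (by positivity)
  have h := hasDerivAt_gaussMoment_comp hf hC n h1 h2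
    (by simp only [Pi.div_apply]; positivity)
  refine h.congr_deriv ?_
  simp only [heatMoment, Pi.add_apply, Pi.div_apply]
  have hS0 := h0.ne'
  have hσ0 := hσ.ne'
  rw [neg_mul_comm]
  congr 2
  · field_simp
    ring
  · field_simp

/-- With m = x + κτ and v = σ²τ, the derivatives are the means of f(y)(y - m)/v and f(y)((y - m)²/v²
- 1/v), expanded in powers of y. -/
lemma isDriftHeatSolution_heatMean (hf : Continuous f) (hC : ∀ y, |f y| ≤ C) (hσ : 0 < σ) :
    IsDriftHeatSolution κ σ (heatMean κ σ f)
      (fun x τ => heatFactor κ σ x τ *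
        (-(x + κ * τ) / (σ ^ 2 * τ) * heatMoment κ σ f 0 x τ +
          heatMoment κ σ f 1 x τ / (σ ^ 2 * τ)))
      (fun x τ => heatFactor κ σ x τ *
        (((x + κ * τ) ^ 2 / (σ ^ 2 * τ) ^ 2 - 1 / (σ ^ 2 * τ)) * heatMoment κ σ f 0 x τ -
          2 * (x + κ * τ) / (σ ^ 2 * τ) ^ 2 * heatMoment κ σ f 1 x τ +
          heatMoment κ σ f 2 x τ / (σ ^ 2 * τ) ^ 2)) := by
  have hcE : ContinuousOn (fun z : ℝ × ℝ => heatFactor κ σ z.1 z.2) {z | 0 < z.2} := by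
    unfold heatFactor
    refine continuousOn_const.mul (ContinuousOn.rexp (ContinuousOn.sub ?_ ?_))
    · exact ContinuousOn.div (by fun_prop) (by fun_prop) fun (z : ℝ × ℝ) (hz : 0 < z.2) => by positivity
    · exact (ContinuousOn.log (by fun_prop) fun (z : ℝ × ℝ) (hz : 0 < z.2) => hz.ne').div_const _
  have hcM : ∀ n, ContinuousOn (fun z : ℝ × ℝ => heatMoment κ σ f n z.1 z.2) {z | 0 < z.2} := by
    intro n
    refine (continuousOn_gaussMoment hf hC n).comp
      (f := fun z : ℝ × ℝ => (1 / (2 * (σ ^ 2 * z.2)), (z.1 + κ * z.2) / (σ ^ 2 * z.2)))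
      (ContinuousOn.prodMk ?_ ?_) (fun (z : ℝ × ℝ) (hz : 0 < z.2) => ?_)
    · exact ContinuousOn.div (by fun_prop) (by fun_prop) fun (z : ℝ × ℝ) (hz : 0 < z.2) => by positivity
    · exact ContinuousOn.div (by fun_prop) (by fun_prop) fun (z : ℝ × ℝ) (hz : 0 < z.2) => by positivity
    · rw [mem_ofPred_eq]; positivity
  refine ⟨fun X S X' S' t hX hS h0 => ?_, fun x τ hτ => ?_,
    (continuous_heatMean hf hC).continuousOn, ?_, ?_⟩
  · have h := (hasDerivAt_heatFactor (κ := κ) hσ hX hS h0).mul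
      (hasDerivAt_heatMoment (κ := κ) hf hC hσ 0 hX hS h0)
    have hev : (fun t => heatMean κ σ f (X t) (S t)) =ᶠ[𝓝 t]
        fun t => heatFactor κ σ (X t) (S t) * heatMoment κ σ f 0 (X t) (S t) := by
      filter_upwards [hS.continuousAt.eventually (lt_mem_nhds h0)] with u hu
      exact heatMean_eq hσ hu
    refine (h.congr_of_eventuallyEq hev).congr_deriv ?_
    simp only [zero_add]
    field_simp
    ring
  · have hE := hasDerivAt_heatFactor (κ := κ) hσ (hasDerivAt_id x) (hasDerivAt_const x τ) hτ
    have hM := fun n => hasDerivAt_heatMoment (κ := κ) hf hC hσ n (hasDerivAt_id x)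
      (hasDerivAt_const x τ) hτ
    have hl : HasDerivAt (fun x : ℝ => -(x + κ * τ) / (σ ^ 2 * τ)) (-1 / (σ ^ 2 * τ)) x :=
      ((hasDerivAt_id x).add_const _).neg.div_const _
    refine (hE.mul ((hl.mul (hM 0)).add ((hM 1).div_const (σ ^ 2 * τ)))).congr_deriv ?_
    simp only [id, zero_add, Pi.add_apply, Pi.mul_apply, Nat.reduceAdd]
    field_simp
    ring
  · refine hcE.mul (ContinuousOn.add (ContinuousOn.mul ?_ (hcM 0)) ((hcM 1).div (by fun_prop) ?_))
    · exact ContinuousOn.div (by fun_prop) (by fun_prop) fun (z : ℝ × ℝ) (hz : 0 < z.2) => by positivity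
    · exact fun (z : ℝ × ℝ) (hz : 0 < z.2) => by positivity
  · refine hcE.mul (((ContinuousOn.mul (ContinuousOn.sub ?_ ?_) (hcM 0)).sub
      (ContinuousOn.mul ?_ (hcM 1))).add ((hcM 2).div (by fun_prop) ?_))
    all_goals first
      | exact ContinuousOn.div (by fun_prop) (by fun_prop) fun (z : ℝ × ℝ) (hz : 0 < z.2) => by positivity
      | exact fun (z : ℝ × ℝ) (hz : 0 < z.2) => by positivity

end

/-! ### The maximum principle -/

/-- A positive second derivative would make the point a local minimum as well, hence g locally
constant, with vanishing second derivative. -/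
lemma nonpos_of_isLocalMax_of_hasDerivAt {g g' : ℝ → ℝ} {g'' x : ℝ} (hmax : IsLocalMax g x)
    (hg : ∀ᶠ y in 𝓝 x, HasDerivAt g (g' y) y) (hg' : HasDerivAt g' g'' x) : g'' ≤ 0 := by
  by_contra! hpos
  have hd : deriv g =ᶠ[𝓝 x] g' := hg.mono fun y hy => hy.deriv
  have h0 : deriv g x = 0 := hmax.deriv_eq_zero
  have h2 : deriv (deriv g) x = g'' := (hg'.congr_of_eventuallyEq hd).deriv
  have hmin := isLocalMin_of_deriv_deriv_pos (h2 ▸ hpos) h0 hg.self_of_nhds.continuousAt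
  have hc : g =ᶠ[𝓝 x] fun _ => g x := by
    filter_upwards [hmax, hmin] with y h1 h2 using le_antisymm h1 h2
  have : deriv (deriv g) x = 0 := by
    rw [(hc.deriv.trans (Eventually.of_forall fun y => deriv_const y (g x))).deriv_eq]
    simp
  linarith

/-- Only later times enter, so the maximum may lie at t = 0, where the time derivative is one-sided.
-/
lemma hasDerivWithinAt_nonpos_of_eventually_le {g : ℝ → ℝ} {g' a b : ℝ} (hab : a < b)
    (hg : HasDerivWithinAt g g' (Ioo a b) a) (hle : ∀ᶠ s in 𝓝[>] a, g s ≤ g a) : g' ≤ 0 := by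
  have h := (hasDerivWithinAt_iff_tendsto_slope' (by simp)).1 hg
  rw [nhdsWithin_Ioo_eq_nhdsGT hab] at h
  refine le_of_tendsto h ?_
  filter_upwards [hle, self_mem_nhdsWithin] with s h1 (h2 : a < s)
  rw [slope_def_field]
  exact div_nonpos_of_nonpos_of_nonneg (by linarith) (by linarith)

/-! ### Uniqueness for the call problem -/

namespace Model

variable {M : Model} {K : ℝ} {P Q : ℝ → ℝ → ℝ}

lemma barrier_pos (hb : 0 < M.b) (t : ℝ) : 0 < M.barrier t := mul_pos hb (Real.exp_pos _)

lemma continuous_barrier : Continuous M.barrier := by unfold barrier; fun_prop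

/-- The corner is covered by neither the boundary nor the terminal condition; its value is the limit
along the barrier. -/
lemma IsCallSolution.apply_barrier_T₁ (hT₁ : 0 < M.T₁) (hP : M.IsCallSolution K P) :
    P (M.barrier M.T₁) M.T₁ = 0 := by
  have h1 : Tendsto (fun t => (M.barrier t, t)) (𝓝[Ico 0 M.T₁] M.T₁)
      (𝓝[M.closedRegion] (M.barrier M.T₁, M.T₁)) := by
    refine tendsto_nhdsWithin_iff.2 ⟨?_, ?_⟩
    · exact ((continuous_barrier.prodMk continuous_id).tendsto _).mono_left nhdsWithin_le_nhds
    · filter_upwards [self_mem_nhdsWithin] with t ht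
      exact ⟨ht.1, ht.2.le, le_rfl⟩
  have h2 := (hP.continuousOn (M.barrier M.T₁, M.T₁) ⟨hT₁.le, le_rfl, le_rfl⟩).tendsto.comp h1
  have h3 : Tendsto (fun _ : ℝ => (0 : ℝ)) (𝓝[Ico 0 M.T₁] M.T₁) (𝓝 (P (M.barrier M.T₁) M.T₁)) := by
    refine h2.congr' ?_
    filter_upwards [self_mem_nhdsWithin] with t ht
    exact hP.boundary t ht.1 ht.2
  have : (𝓝[Ico 0 M.T₁] M.T₁).NeBot := by
    rw [nhdsWithin_Ico_eq_nhdsLT hT₁]; infer_instance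
  exact tendsto_nhds_unique h3 tendsto_const_nhds |>.symm ▸ rfl

lemma isClosed_closedRegion : IsClosed M.closedRegion := by
  have := M.continuous_barrier
  exact (isClosed_le continuous_const continuous_snd).inter
    ((isClosed_le continuous_snd continuous_const).inter
      (isClosed_le (this.comp continuous_snd) continuous_fst))

lemma IsCallSolution.exists_abs_sub_le (hP : M.IsCallSolution K P)
    (hQ : M.IsCallSolution K Q) : ∃ (A : ℝ) (n : ℕ), 0 ≤ A ∧ ∀ z ∈ M.closedRegion, 1 ≤ z.1 →
      |P z.1 z.2 - Q z.1 z.2| ≤ A * z.1 ^ n := by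
  obtain ⟨C, m, hC⟩ := hP.growth
  obtain ⟨C', m', hC'⟩ := hQ.growth
  refine ⟨2 * (|C| + |C'|), max m m', by positivity, fun z hz h1 => ?_⟩
  have key : ∀ (c : ℝ) (k : ℕ), k ≤ max m m' → c * (1 + z.1 ^ k) ≤ 2 * |c| * z.1 ^ (max m m') := by
    intro c k hk
    have h2 : (1 : ℝ) ≤ z.1 ^ k := one_le_pow₀ h1
    have h3 : z.1 ^ k ≤ z.1 ^ (max m m') := pow_le_pow_right₀ h1 hk
    calc c * (1 + z.1 ^ k) ≤ |c| * (1 + z.1 ^ k) := by gcongr; exact le_abs_self c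
      _ ≤ |c| * (2 * z.1 ^ (max m m')) := by gcongr; linarith
      _ = _ := by ring
  have := abs_sub (P z.1 z.2) (Q z.1 z.2)
  have a1 := (hC z hz).trans (key C m (le_max_left _ _))
  have a2 := (hC' z hz).trans (key C' m' (le_max_right _ _))
  linarith

/-- Comparison with a supersolution growing faster than `P - Q`. -/
lemma IsCallSolution.sub_le_mul (hb : 0 < M.b) (hσ : 0 < M.σ) (hT₁ : 0 < M.T₁)
    (hP : M.IsCallSolution K P) (hQ : M.IsCallSolution K Q) :
    ∃ (c : ℝ) (n : ℕ), ∀ ε > 0, ∀ z ∈ M.closedRegion,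
      Real.exp (-M.r * z.2) * (P z.1 z.2 - Q z.1 z.2) ≤
        ε * (Real.exp (c * (M.T₁ - z.2)) * z.1 ^ n) := by
  obtain ⟨A, n, hA, hbd⟩ := hP.exists_abs_sub_le hQ
  -- The spatial operator without the discount term multiplies V^{n+1} by the number inside the
  -- absolute value. The extra 1 makes the comparison function a strict supersolution.
  set c : ℝ := |M.σ ^ 2 / 2 * (n + 1) * n + (M.r - M.q) * (n + 1)| + 1 with hc
  have hc0 : 0 < c := by positivity
  refine ⟨c, n + 1, fun ε hε z₀ hz₀ => ?_⟩
  by_contra! hcon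
  set w : ℝ → ℝ → ℝ := fun V t => Real.exp (-M.r * t) * (P V t - Q V t) -
    ε * (Real.exp (c * (M.T₁ - t)) * V ^ (n + 1)) with hw
  have hw0 : 0 < w z₀.1 z₀.2 := by simp only [hw]; linarith
  have hVpos : ∀ z ∈ M.closedRegion, 0 < z.1 := fun z hz => (barrier_pos hb z.2).trans_le hz.2.2
  -- Beyond L the extra power of V beats the bound A·Vⁿ, so a positive maximum lies in a compact
  -- set.
  set L : ℝ := max 1 (Real.exp (|M.r| * M.T₁) * A / ε) with hL
  have hfar : ∀ z ∈ M.closedRegion, L ≤ z.1 → w z.1 z.2 ≤ 0 := by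
    intro z hz hLz
    have h1 : 1 ≤ z.1 := (le_max_left _ _).trans hLz
    have h2 : Real.exp (|M.r| * M.T₁) * A ≤ z.1 * ε := by
      have := (le_max_right _ _).trans hLz
      rwa [div_le_iff₀ hε] at this
    have h3 : Real.exp (-M.r * z.2) ≤ Real.exp (|M.r| * M.T₁) := by
      refine Real.exp_le_exp.2 ?_
      calc -M.r * z.2 ≤ |M.r| * z.2 := mul_le_mul_of_nonneg_right (neg_le_abs _) hz.1
        _ ≤ _ := mul_le_mul_of_nonneg_left hz.2.1 (abs_nonneg _)
    have h4 : 1 ≤ Real.exp (c * (M.T₁ - z.2)) :=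
      Real.one_le_exp (mul_nonneg hc0.le (by linarith [hz.2.1]))
    have h5 : 0 < z.1 ^ n := pow_pos (hVpos z hz) _
    have hz0 := hVpos z hz
    have : Real.exp (-M.r * z.2) * (P z.1 z.2 - Q z.1 z.2) ≤ ε * (1 * z.1 ^ (n + 1)) := by
      calc _ ≤ Real.exp (-M.r * z.2) * (A * z.1 ^ n) := by
            gcongr; exact (le_abs_self _).trans (hbd z hz h1)
        _ ≤ Real.exp (|M.r| * M.T₁) * (A * z.1 ^ n) := by gcongr
        _ = Real.exp (|M.r| * M.T₁) * A * z.1 ^ n := by ring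
        _ ≤ z.1 * ε * z.1 ^ n := by gcongr
        _ = _ := by ring
    have h6 : ε * (1 * z.1 ^ (n + 1)) ≤ ε * (Real.exp (c * (M.T₁ - z.2)) * z.1 ^ (n + 1)) := by
      gcongr
    simp only [hw]; linarith
  set S : Set (ℝ × ℝ) := M.closedRegion ∩ {z | z.1 ≤ L} with hS
  have hScomp : IsCompact S := by
    refine (isCompact_Icc.prod isCompact_Icc : IsCompact (Icc (0 : ℝ) L ×ˢ Icc 0 M.T₁)).of_isClosed_subset
      (isClosed_closedRegion.inter (isClosed_le continuous_fst continuous_const)) ?_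
    rintro z ⟨hz, hzL⟩
    exact ⟨⟨(hVpos z hz).le, hzL⟩, hz.1, hz.2.1⟩
  have hz₀S : z₀ ∈ S := by
    refine ⟨hz₀, ?_⟩
    by_contra h
    have := hfar z₀ hz₀ (not_le.1 h).le
    linarith
  have hwc : ContinuousOn (fun z : ℝ × ℝ => w z.1 z.2) S := by
    have := hP.continuousOn.mono (inter_subset_left : S ⊆ _)
    have := hQ.continuousOn.mono (inter_subset_left : S ⊆ _)
    simp only [hw]
    fun_prop
  obtain ⟨⟨V, t⟩, hzS, hmax⟩ := hScomp.exists_isMaxOn ⟨z₀, hz₀S⟩ hwc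
  have hpos : 0 < w V t := hw0.trans_le (hmax hz₀S)
  have hV : 0 < V := hVpos _ hzS.1
  have hVL : V < L := by
    by_contra h
    have := hfar _ hzS.1 (not_lt.1 h)
    simp only at this
    linarith
  have hψ : 0 < ε * (Real.exp (c * (M.T₁ - t)) * V ^ (n + 1)) := by positivity
  -- Where the two solutions agree, w is negative; this excludes the terminal line, the barrier and
  -- the corner as locations of the maximum.
  have hne : P V t ≠ Q V t := fun h => by
    have e : w V t = -(ε * (Real.exp (c * (M.T₁ - t)) * V ^ (n + 1))) := by
      simp only [hw]; rw [h]; ring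
    linarith
  obtain ⟨ht0, htT, hVb⟩ := hzS.1
  simp only at ht0 htT hVb
  have htlt : t < M.T₁ := by
    refine lt_of_le_of_ne htT fun h => hne ?_
    subst h
    rcases hVb.eq_or_lt with h | h
    · rw [← h, hP.apply_barrier_T₁ hT₁, hQ.apply_barrier_T₁ hT₁]
    · rw [hP.terminal V h, hQ.terminal V h]
  have hVlt : M.barrier t < V := by
    refine lt_of_le_of_ne hVb fun h => hne ?_
    rw [← h, hP.boundary t ht0 htlt, hQ.boundary t ht0 htlt]
  obtain ⟨Pt, PV, PVV, -, -, -, hPe⟩ := hP.equation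
  obtain ⟨Qt, QV, QVV, -, -, -, hQe⟩ := hQ.equation
  obtain ⟨p1, p2, p3, p4⟩ := hPe V t ⟨ht0, htlt, hVlt⟩
  obtain ⟨q1, q2, q3, q4⟩ := hQe V t ⟨ht0, htlt, hVlt⟩
  have hVmax : IsLocalMax (fun v => w v t) V := by
    filter_upwards [lt_mem_nhds hVlt, gt_mem_nhds hVL] with v h1 h2
    exact hmax (show (v, t) ∈ S from ⟨⟨ht0, htT, h1.le⟩, h2.le⟩)
  have hwV : ∀ v, M.barrier t < v → HasDerivAt (fun v => w v t)
      (Real.exp (-M.r * t) * (PV v t - QV v t) -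
        ε * (Real.exp (c * (M.T₁ - t)) * ((n + 1) * v ^ n))) v := by
    intro v hv
    have a1 := (hPe v t ⟨ht0, htlt, hv⟩).2.1
    have a2 := (hQe v t ⟨ht0, htlt, hv⟩).2.1
    have a3 := (((hasDerivAt_pow (n + 1) v).const_mul (Real.exp (c * (M.T₁ - t)))).const_mul ε)
    refine (((a1.sub a2).const_mul _).sub a3).congr_deriv ?_
    push_cast
    simp
  have hwVV : HasDerivAt (fun v => Real.exp (-M.r * t) * (PV v t - QV v t) -
        ε * (Real.exp (c * (M.T₁ - t)) * ((n + 1) * v ^ n)))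
      (Real.exp (-M.r * t) * (PVV V t - QVV V t) -
        ε * (Real.exp (c * (M.T₁ - t)) * ((n + 1) * (n * V ^ (n - 1))))) V :=
    ((p3.sub q3).const_mul _).sub
      ((((hasDerivAt_pow n V).const_mul ((n : ℝ) + 1)).const_mul _).const_mul ε)
  have e1 := hVmax.hasDerivAt_eq_zero (hwV V hVlt)
  have e2 := nonpos_of_isLocalMax_of_hasDerivAt hVmax
    ((lt_mem_nhds hVlt).mono fun v hv => hwV v hv) hwVV
  have hwt : HasDerivWithinAt (fun s => w V s) (Real.exp (-M.r * t) * (-M.r) * (P V t - Q V t) +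
      Real.exp (-M.r * t) * (Pt V t - Qt V t) -
        ε * (Real.exp (c * (M.T₁ - t)) * (-c) * V ^ (n + 1))) (Icc 0 M.T₁) t := by
    have a1 : HasDerivAt (fun s => Real.exp (-M.r * s)) (Real.exp (-M.r * t) * (-M.r)) t := by
      have := ((hasDerivAt_id t).const_mul (-M.r)).exp
      refine this.congr_deriv ?_
      simp
    have a2 : HasDerivAt (fun s => Real.exp (c * (M.T₁ - s)))
        (Real.exp (c * (M.T₁ - t)) * (-c)) t := by
      have := (((hasDerivAt_id t).const_sub M.T₁).const_mul c).exp
      refine this.congr_deriv ?_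
      simp
    exact (a1.hasDerivWithinAt.mul (p1.sub q1)).sub
      ((a2.mul_const _).const_mul ε).hasDerivWithinAt
  have e3 := hasDerivWithinAt_nonpos_of_eventually_le htlt
    (hwt.mono fun s hs => ⟨ht0.trans hs.1.le, hs.2.le⟩) (by
      have hb' : ∀ᶠ s in 𝓝[>] t, M.barrier s < V :=
        (M.continuous_barrier.continuousAt.eventually (gt_mem_nhds hVlt)).filter_mono
          nhdsWithin_le_nhds
      have hT' : ∀ᶠ s in 𝓝[>] t, s < M.T₁ := (gt_mem_nhds htlt).filter_mono nhdsWithin_le_nhds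
      filter_upwards [hb', hT', self_mem_nhdsWithin] with s h1 h2 (h3 : t < s)
      exact hmax (show (V, s) ∈ S from ⟨⟨ht0.trans h3.le, h2.le, h1.le⟩, hVL.le⟩))
  -- For n = 0 the truncated exponent n - 1 is harmless because of the factor n.
  have hn : (n : ℝ) * V ^ (n - 1) * V = n * V ^ n := by
    rcases n with _ | k
    · simp
    · simp only [Nat.add_sub_cancel]; ring
  set X := Real.exp (-M.r * t) with hX
  set Y := Real.exp (c * (M.T₁ - t)) with hY
  have hYp : 0 < Y := Real.exp_pos _
  have e4 : 1 / 2 * M.σ ^ 2 * V ^ 2 * (X * (PVV V t - QVV V t) -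
      ε * (Y * ((n + 1) * (n * V ^ (n - 1))))) ≤ 0 :=
    mul_nonpos_of_nonneg_of_nonpos (by positivity) e2
  have e5 : (M.r - M.q) * V * (X * (PV V t - QV V t) - ε * (Y * ((n + 1) * V ^ n))) = 0 := by
    rw [e1, mul_zero]
  have e6 : V ^ 2 * (n * V ^ (n - 1)) = n * V ^ (n + 1) := by
    calc _ = V * (n * V ^ (n - 1) * V) := by ring
      _ = _ := by rw [hn]; ring
  -- The conditions w_t ≤ 0, w_V = 0, w_VV ≤ 0 at the maximum are added with the coefficients of the
  -- operator. The two equations cancel P and Q, leaving only the comparison function, whose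
  -- contribution is positive by the choice of c.
  have e7 : ε * Y * V ^ (n + 1) *
      (c - (M.σ ^ 2 / 2 * (n + 1) * n + (M.r - M.q) * (n + 1))) ≤ 0 := by
    have : ε * Y * V ^ (n + 1) *
        (c - (M.σ ^ 2 / 2 * (n + 1) * n + (M.r - M.q) * (n + 1))) =
        (X * (-M.r) * (P V t - Q V t) + X * (Pt V t - Qt V t) - ε * (Y * (-c) * V ^ (n + 1))) +
        1 / 2 * M.σ ^ 2 * V ^ 2 * (X * (PVV V t - QVV V t) -
          ε * (Y * ((n + 1) * (n * V ^ (n - 1))))) +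
        (M.r - M.q) * V * (X * (PV V t - QV V t) - ε * (Y * ((n + 1) * V ^ n))) := by
      linear_combination (-X) * p4 + X * q4 + 1 / 2 * M.σ ^ 2 * ε * Y * (n + 1) * e6
    rw [this, e5]
    linarith
  have e8 : 0 < ε * Y * V ^ (n + 1) *
      (c - (M.σ ^ 2 / 2 * (n + 1) * n + (M.r - M.q) * (n + 1))) := by
    refine mul_pos (by positivity) ?_
    have := le_abs_self (M.σ ^ 2 / 2 * (n + 1) * n + (M.r - M.q) * (n + 1))
    rw [hc]; linarith
  linarith

lemma IsCallSolution.le (hb : 0 < M.b) (hσ : 0 < M.σ) (hT₁ : 0 < M.T₁)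
    (hP : M.IsCallSolution K P) (hQ : M.IsCallSolution K Q) {z : ℝ × ℝ}
    (hz : z ∈ M.closedRegion) : P z.1 z.2 ≤ Q z.1 z.2 := by
  obtain ⟨c, n, h⟩ := hP.sub_le_mul hb hσ hT₁ hQ
  have hlim : Tendsto (fun ε : ℝ => ε * (Real.exp (c * (M.T₁ - z.2)) * z.1 ^ n)) (𝓝[>] 0) (𝓝 0) := by
    have : Continuous (fun ε : ℝ => ε * (Real.exp (c * (M.T₁ - z.2)) * z.1 ^ n)) := by fun_prop
    simpa using (this.tendsto 0).mono_left nhdsWithin_le_nhds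
  have h0 : Real.exp (-M.r * z.2) * (P z.1 z.2 - Q z.1 z.2) ≤ 0 :=
    ge_of_tendsto hlim (by filter_upwards [self_mem_nhdsWithin] with ε hε using h ε hε z hz)
  have := nonpos_of_mul_nonpos_right h0 (Real.exp_pos _)
  linarith

/-- The terminal boundary value problem has at most one solution. -/
lemma IsCallSolution.unique (hb : 0 < M.b) (hσ : 0 < M.σ) (hT₁ : 0 < M.T₁)
    (hP : M.IsCallSolution K P) (hQ : M.IsCallSolution K Q) {z : ℝ × ℝ}
    (hz : z ∈ M.closedRegion) : P z.1 z.2 = Q z.1 z.2 :=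
  le_antisymm (hP.le hb hσ hT₁ hQ hz) (hQ.le hb hσ hT₁ hP hz)

end Model

/-! ### The bivariate normal distribution function as a mean of `N` -/

lemma setIntegral_Iic_comp_sub_div (g : ℝ → ℝ) (a m : ℝ) {c : ℝ} (hc : 0 < c) :
    ∫ y in Iic a, g ((y - m) / c) = c * ∫ y in Iic ((a - m) / c), g y := by
  rw [← integral_indicator measurableSet_Iic, ← integral_indicator measurableSet_Iic]
  have h : (Iic a).indicator (fun y => g ((y - m) / c)) =
      fun y => (Iic ((a - m) / c)).indicator g ((y - m) / c) := by
    funext y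
    have : y ∈ Iic a ↔ (y - m) / c ∈ Iic ((a - m) / c) := by
      rw [mem_Iic, mem_Iic, div_le_div_iff_of_pos_right hc]; simp
    by_cases hy : y ∈ Iic a
    · rw [indicator_of_mem hy, indicator_of_mem (this.1 hy)]
    · rw [indicator_of_notMem hy, indicator_of_notMem (mt this.2 hy)]
  rw [h, integral_sub_right_eq_self (fun y => (Iic ((a - m) / c)).indicator g (y / c)) m,
    Measure.integral_comp_div, abs_of_pos hc, smul_eq_mul]

lemma setIntegral_Iic_exp_sub_div (a m : ℝ) {c : ℝ} (hc : 0 < c) :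
    ∫ y in Iic a, Real.exp (-((y - m) / c) ^ 2 / 2) =
      c * (Real.sqrt (2 * Real.pi) * normalCDF ((a - m) / c)) := by
  rw [setIntegral_Iic_comp_sub_div (fun y => Real.exp (-y ^ 2 / 2)) a m hc, normalCDF]
  have := sqrt_two_pi_pos
  field_simp

/-- The quadratic form is at least (1 - |ρ|)(y₁² + y₂²), and 1 - ρ² = (1 - |ρ|)(1 + |ρ|) with 1 +
|ρ| ≤ 2; hence the constant 1/4, whatever ρ. -/
lemma integrable_binormal {ρ : ℝ} (hρ : ρ ^ 2 < 1) :
    Integrable (fun p : ℝ × ℝ =>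
      Real.exp (-(p.1 ^ 2 - 2 * ρ * p.1 * p.2 + p.2 ^ 2) / (2 * (1 - ρ ^ 2)))) := by
  have h := (integrable_exp_neg_mul_sq (b := 1 / 4) (by norm_num)).mul_prod
    (integrable_exp_neg_mul_sq (b := 1 / 4) (by norm_num))
  refine h.mono' (by fun_prop) (ae_of_all _ fun p => ?_)
  rw [Real.norm_of_nonneg (Real.exp_pos _).le, ← Real.exp_add]
  refine Real.exp_le_exp.2 ?_
  have h1 : 0 < 1 - ρ ^ 2 := by linarith
  rw [div_le_iff₀ (by positivity)]
  have habs : |ρ| < 1 := by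
    rw [← sq_abs] at hρ; nlinarith [abs_nonneg ρ]
  have h2 : 2 * ρ * p.1 * p.2 ≤ |ρ| * (p.1 ^ 2 + p.2 ^ 2) := by
    rcases abs_cases ρ with ⟨h, h'⟩ | ⟨h, h'⟩ <;> rw [h]
    · nlinarith [mul_nonneg h' (sq_nonneg (p.1 - p.2))]
    · nlinarith [mul_nonneg (neg_nonneg.2 h'.le) (sq_nonneg (p.1 + p.2))]
  have h3 : ρ ^ 2 = |ρ| ^ 2 := (sq_abs ρ).symm
  rw [h3]
  nlinarith [mul_nonneg (sq_nonneg (1 - |ρ|)) (add_nonneg (sq_nonneg p.1) (sq_nonneg p.2))]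

/-- Given the second variable y, the first is normal with mean ρy and variance 1 - ρ²; Fubini allows
integrating it first. -/
lemma binormalCDF_eq {ρ : ℝ} (hρ : ρ ^ 2 < 1) (a₁ a₂ : ℝ) :
    binormalCDF a₁ a₂ ρ = 1 / Real.sqrt (2 * Real.pi) *
      ∫ y in Iic a₂, Real.exp (-y ^ 2 / 2) * normalCDF ((a₁ - ρ * y) / Real.sqrt (1 - ρ ^ 2)) := by
  have h1 : 0 < 1 - ρ ^ 2 := by linarith
  have hc : 0 < Real.sqrt (1 - ρ ^ 2) := Real.sqrt_pos.2 h1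
  have hq : Real.sqrt (1 - ρ ^ 2) ^ 2 = 1 - ρ ^ 2 := Real.sq_sqrt h1.le
  have hs := sqrt_two_pi_pos
  have hs2 : Real.sqrt (2 * Real.pi) ^ 2 = 2 * Real.pi := Real.sq_sqrt (by positivity)
  have hint : Integrable (Function.uncurry fun y₁ y₂ : ℝ =>
      Real.exp (-(y₁ ^ 2 - 2 * ρ * y₁ * y₂ + y₂ ^ 2) / (2 * (1 - ρ ^ 2))))
      ((volume.restrict (Iic a₁)).prod (volume.restrict (Iic a₂))) := by
    rw [Measure.prod_restrict]
    exact (integrable_binormal hρ).restrict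
  have hinner : ∀ y₂ : ℝ, ∫ y₁ in Iic a₁,
      Real.exp (-(y₁ ^ 2 - 2 * ρ * y₁ * y₂ + y₂ ^ 2) / (2 * (1 - ρ ^ 2))) =
      Real.sqrt (1 - ρ ^ 2) * Real.sqrt (2 * Real.pi) * (Real.exp (-y₂ ^ 2 / 2) *
        normalCDF ((a₁ - ρ * y₂) / Real.sqrt (1 - ρ ^ 2))) := by
    intro y₂
    have e : ∀ y₁ : ℝ, Real.exp (-(y₁ ^ 2 - 2 * ρ * y₁ * y₂ + y₂ ^ 2) / (2 * (1 - ρ ^ 2))) =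
        Real.exp (-y₂ ^ 2 / 2) *
          Real.exp (-((y₁ - ρ * y₂) / Real.sqrt (1 - ρ ^ 2)) ^ 2 / 2) := fun y₁ => by
      rw [← Real.exp_add, div_pow, hq]
      congr 1
      field_simp
      ring
    simp only [e]
    rw [integral_const_mul, setIntegral_Iic_exp_sub_div _ _ hc]
    ring
  rw [binormalCDF, integral_integral_swap hint]
  simp only [hinner]
  rw [integral_const_mul, ← mul_assoc]
  congr 1
  field_simp
  exact hs2

lemma integrable_exp_mul_normalCDF (l : ℝ → ℝ) (hl : Continuous l) :
    Integrable fun y : ℝ => Real.exp (-y ^ 2 / 2) * normalCDF (l y) := by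
  have := continuous_normalCDF
  refine integrable_exp_neg_sq_div_two.mono' (by fun_prop) (ae_of_all _ fun y => ?_)
  rw [norm_mul, Real.norm_of_nonneg (Real.exp_pos _).le, Real.norm_of_nonneg (normalCDF_nonneg _)]
  exact mul_le_of_le_one_right (Real.exp_pos _).le (normalCDF_le_one _)

/-- For independent standard normal Y, Z the integrand conditions the event sY + ℓZ ≤ A on Y, and
(sY + ℓZ)/L is standard normal with correlation s/L to Y. The sign of s is free, as the reflected
term requires. -/
lemma setIntegral_exp_mul_normalCDF {s ℓ L : ℝ} (hℓ : 0 < ℓ) (hL : 0 < L)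
    (h : L ^ 2 = ℓ ^ 2 + s ^ 2) (A a : ℝ) :
    1 / Real.sqrt (2 * Real.pi) *
      ∫ y in Iic a, Real.exp (-y ^ 2 / 2) * normalCDF ((A - s * y) / ℓ) =
        binormalCDF (A / L) a (s / L) := by
  have h1 : 1 - (s / L) ^ 2 = (ℓ / L) ^ 2 := by
    field_simp; linarith
  have h2 : (s / L) ^ 2 < 1 := by
    have : 0 < (ℓ / L) ^ 2 := by positivity
    linarith
  rw [binormalCDF_eq h2, h1, Real.sqrt_sq (by positivity)]
  congr 2
  funext y
  congr 2
  field_simp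

/-- The Gaussian mean of a function that vanishes below `k`. -/
lemma heatMean_indicator {κ σ : ℝ} (hσ : 0 < σ) (F : ℝ → ℝ) (k x : ℝ) {τ : ℝ} (hτ : 0 < τ) :
    heatMean κ σ ((Ici k).indicator F) x τ = 1 / Real.sqrt (2 * Real.pi) *
      ∫ y in Iic ((x + κ * τ - k) / (σ * Real.sqrt τ)),
        F (x + κ * τ - σ * Real.sqrt τ * y) * Real.exp (-y ^ 2 / 2) := by
  have hs : 0 < σ * Real.sqrt τ := mul_pos hσ (Real.sqrt_pos.2 hτ)
  set s := σ * Real.sqrt τ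
  set m := x + κ * τ with hm
  rw [heatMean, ← hm]
  congr 1
  -- The change y ↦ -y turns the upper half-line into the lower one used by N and N₂.
  rw [← integral_indicator measurableSet_Iic, ← integral_neg_eq_self]
  congr 1
  funext y
  have : y ∈ Iic ((m - k) / s) ↔ m + s * -y ∈ Ici k := by
    rw [mem_Iic, mem_Ici, le_div_iff₀ hs]
    constructor <;> intro h <;> linarith
  by_cases hy : y ∈ Iic ((m - k) / s)
  · rw [indicator_of_mem hy, indicator_of_mem (this.1 hy), neg_sq, mul_neg, ← sub_eq_add_neg]
  · rw [indicator_of_notMem hy, indicator_of_notMem (mt this.2 hy), zero_mul]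

/-- The Gaussian mean of an affine function of the survival probability, cut off below `k`. -/
lemma heatMean_indicator_survivalProb {κ σ τ θ : ℝ} (hσ : 0 < σ) (hτ : 0 < τ) (hθ : 0 < θ)
    (c₁ c₂ k x : ℝ) :
    heatMean κ σ ((Ici k).indicator fun y => c₁ + c₂ * survivalProb κ σ θ y) x τ =
      c₁ * normalCDF ((x + κ * τ - k) / (σ * Real.sqrt τ)) +
      c₂ * (binormalCDF ((x + κ * (τ + θ)) / (σ * Real.sqrt (τ + θ)))
          ((x + κ * τ - k) / (σ * Real.sqrt τ)) (Real.sqrt (τ / (τ + θ))) -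
        Real.exp (-2 * κ / σ ^ 2 * x) * binormalCDF ((-x + κ * (τ + θ)) / (σ * Real.sqrt (τ + θ)))
          ((x - κ * τ - k) / (σ * Real.sqrt τ)) (-Real.sqrt (τ / (τ + θ)))) := by
  rw [heatMean_indicator hσ _ _ _ hτ]
  have hτs : 0 < Real.sqrt τ := Real.sqrt_pos.2 hτ
  have hτq : Real.sqrt τ ^ 2 = τ := Real.sq_sqrt hτ.le
  have hℓ : 0 < σ * Real.sqrt θ := mul_pos hσ (Real.sqrt_pos.2 hθ)
  have hL : 0 < σ * Real.sqrt (τ + θ) := mul_pos hσ (Real.sqrt_pos.2 (by positivity))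
  have hρ : Real.sqrt (τ / (τ + θ)) = σ * Real.sqrt τ / (σ * Real.sqrt (τ + θ)) := by
    rw [Real.sqrt_div hτ.le, mul_div_mul_left _ _ hσ.ne']
  have hLsq : (σ * Real.sqrt (τ + θ)) ^ 2 = (σ * Real.sqrt θ) ^ 2 + (σ * Real.sqrt τ) ^ 2 := by
    rw [mul_pow, mul_pow, mul_pow, Real.sq_sqrt (by positivity), Real.sq_sqrt hτ.le,
      Real.sq_sqrt hθ.le]
    ring
  set a := (x + κ * τ - k) / (σ * Real.sqrt τ) with ha
  -- The exponential weight of the second survival term shifts the Gaussian by 2κ√τ/σ. The shift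
  -- reverses the drift in the integration limit, and the reflected argument reverses the sign of
  -- the correlation: this is the origin of b₅ and -ρ.
  have hsplit : ∀ y : ℝ, (c₁ + c₂ * survivalProb κ σ θ (x + κ * τ - σ * Real.sqrt τ * y)) *
      Real.exp (-y ^ 2 / 2) = c₁ * Real.exp (-y ^ 2 / 2) +
      c₂ * (Real.exp (-y ^ 2 / 2) *
        normalCDF ((x + κ * (τ + θ) - σ * Real.sqrt τ * y) / (σ * Real.sqrt θ))) -
      c₂ * Real.exp (-2 * κ / σ ^ 2 * x) *
        (Real.exp (-(y - 2 * κ / σ * Real.sqrt τ) ^ 2 / 2) *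
        normalCDF ((-x + κ * (τ + θ) -
          -(σ * Real.sqrt τ) * (y - 2 * κ / σ * Real.sqrt τ)) / (σ * Real.sqrt θ))) := by
    intro y
    have e1 : Real.exp (-2 * κ / σ ^ 2 * (x + κ * τ - σ * Real.sqrt τ * y)) *
        Real.exp (-y ^ 2 / 2) = Real.exp (-2 * κ / σ ^ 2 * x) *
          Real.exp (-(y - 2 * κ / σ * Real.sqrt τ) ^ 2 / 2) := by
      rw [← Real.exp_add, ← Real.exp_add]
      congr 1
      field_simp
      linear_combination 4 * κ ^ 2 * hτq
    have e2 : -x + κ * (τ + θ) - -(σ * Real.sqrt τ) * (y - 2 * κ / σ * Real.sqrt τ) =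
        -(x + κ * τ - σ * Real.sqrt τ * y) + κ * θ := by
      have : σ * Real.sqrt τ * (2 * κ / σ * Real.sqrt τ) = 2 * κ * τ := by
        calc _ = 2 * κ * Real.sqrt τ ^ 2 := by field_simp
          _ = _ := by rw [hτq]
      linear_combination -this
    have e3 : x + κ * (τ + θ) - σ * Real.sqrt τ * y =
        x + κ * τ - σ * Real.sqrt τ * y + κ * θ := by ring
    rw [e2, e3, survivalProb]
    linear_combination (-c₂ * normalCDF ((-(x + κ * τ - σ * Real.sqrt τ * y) + κ * θ) /
      (σ * Real.sqrt θ))) * e1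
  have i1 := integrable_exp_neg_sq_div_two.const_mul c₁
  have i2 := (integrable_exp_mul_normalCDF (fun y =>
    (x + κ * (τ + θ) - σ * Real.sqrt τ * y) / (σ * Real.sqrt θ)) (by fun_prop)).const_mul c₂
  have i3 := (((integrable_exp_mul_normalCDF (fun y =>
    (-x + κ * (τ + θ) - -(σ * Real.sqrt τ) * y) / (σ * Real.sqrt θ))
      (by fun_prop)).comp_sub_right (2 * κ / σ * Real.sqrt τ))).const_mul
        (c₂ * Real.exp (-2 * κ / σ ^ 2 * x))
  have hshift := setIntegral_Iic_comp_sub_div (fun y => Real.exp (-y ^ 2 / 2) *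
    normalCDF ((-x + κ * (τ + θ) - -(σ * Real.sqrt τ) * y) / (σ * Real.sqrt θ))) a
      (2 * κ / σ * Real.sqrt τ) one_pos
  simp only [div_one, one_mul] at hshift
  have ha' : a - 2 * κ / σ * Real.sqrt τ = (x - κ * τ - k) / (σ * Real.sqrt τ) := by
    rw [ha]
    field_simp
    rw [hτq]
    ring
  simp only [hsplit]
  have hsub := integral_sub (i1.add i2).integrableOn (i3.integrableOn (s := Iic a))
  simp only [Pi.add_apply] at hsub
  rw [hsub, integral_add i1.integrableOn i2.integrableOn, integral_const_mul, integral_const_mul,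
    integral_const_mul, hshift, ha', hρ, ← neg_div,
    ← setIntegral_exp_mul_normalCDF hℓ hL hLsq,
    ← setIntegral_exp_mul_normalCDF hℓ hL (by rw [neg_sq]; exact hLsq), normalCDF]
  ring

namespace Model

variable {M : Model}

/-! ### The model in logarithmic variables -/

lemma expo_eq (hσ : 0 < M.σ) : M.expo = -2 * M.drift / M.σ ^ 2 := by
  unfold expo drift
  field_simp
  ring

lemma log_barrier_div (V t : ℝ) : Real.log (M.barrier t / V) = -Real.log (V / M.barrier t) := by
  rw [← Real.log_inv, inv_div]

lemma div_barrier_rpow_expo (hb : 0 < M.b) {V : ℝ} (hV : 0 < V) (t : ℝ) :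
    (V / M.barrier t) ^ M.expo = Real.exp (M.expo * Real.log (V / M.barrier t)) := by
  rw [Real.rpow_def_of_pos (div_pos hV (barrier_pos hb t)), mul_comm]

lemma survival_eq (hσ : 0 < M.σ) (hb : 0 < M.b) {V : ℝ} (hV : 0 < V) (t : ℝ) :
    M.survival V t =
      survivalProb M.drift M.σ (M.T - t) (Real.log (V / M.barrier t)) := by
  rw [survival, div_barrier_rpow_expo hb hV, survivalProb, d, dTilde, log_barrier_div, expo_eq hσ]

/-- The value of the bond at `T₁` minus the exercise price, for zero survival probability. -/
noncomputable def recoveryExcess (M : Model) : ℝ := M.R * Real.exp (-M.r * (M.T - M.T₁)) - M.E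

/-- The part of the bond value at `T₁` that is lost at default. -/
noncomputable def lossAmount (M : Model) : ℝ := (1 - M.R) * Real.exp (-M.r * (M.T - M.T₁))

lemma bond_sub_eq (hσ : 0 < M.σ) (hb : 0 < M.b) {V : ℝ} (hV : 0 < V) :
    M.bond V M.T₁ - M.E = M.recoveryExcess + M.lossAmount *
      survivalProb M.drift M.σ (M.T - M.T₁) (Real.log (V / M.barrier M.T₁)) := by
  rw [bond, survival_eq hσ hb hV, recoveryExcess, lossAmount]
  ring

lemma recoveryExcess_neg (hE₁ : Real.exp (-M.r * (M.T - M.T₁)) * M.R < M.E) :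
    M.recoveryExcess < 0 := by unfold recoveryExcess; linarith

lemma lossAmount_pos (hR₁ : M.R < 1) : 0 < M.lossAmount :=
  mul_pos (by linarith) (Real.exp_pos _)

/-- The excess of the bond value over the exercise price changes sign at some `k > 0`. -/
lemma exists_logBoundary (hσ : 0 < M.σ) (hR₁ : M.R < 1) (hT : M.T₁ < M.T)
    (hE₁ : Real.exp (-M.r * (M.T - M.T₁)) * M.R < M.E)
    (hE₂ : M.E < Real.exp (-M.r * (M.T - M.T₁))) :
    ∃ k, 0 < k ∧ ∀ x, 0 ≤ x →
      (x < k → M.recoveryExcess + M.lossAmount *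
        survivalProb M.drift M.σ (M.T - M.T₁) x < 0) ∧
      (k ≤ x → 0 ≤ M.recoveryExcess + M.lossAmount *
        survivalProb M.drift M.σ (M.T - M.T₁) x) := by
  have hθ : 0 < M.T - M.T₁ := by linarith
  have h1 := recoveryExcess_neg hE₁
  have h2 := lossAmount_pos hR₁
  set g : ℝ → ℝ := fun x => M.recoveryExcess + M.lossAmount *
    survivalProb M.drift M.σ (M.T - M.T₁) x with hg
  have hmono : StrictMonoOn g (Ici 0) := fun x hx y hy hxy => by
    have := strictMonoOn_survivalProb (κ := M.drift) hσ hθ hx hy hxy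
    simp only [hg]; gcongr
  have hcont : Continuous g := continuous_const.add (continuous_const.mul continuous_survivalProb)
  have hlim : Tendsto g atTop (𝓝 (M.recoveryExcess + M.lossAmount * 1)) :=
    ((tendsto_survivalProb_atTop hσ hθ).const_mul _).const_add _
  -- The limit is e^{-r(T-T₁)} - E, where the recovery rate has cancelled.
  have hpos : 0 < M.recoveryExcess + M.lossAmount * 1 := by
    unfold recoveryExcess lossAmount; linarith
  obtain ⟨A, hA0, hA⟩ := ((eventually_ge_atTop (0 : ℝ)).and
    (hlim.eventually (lt_mem_nhds hpos))).exists
  have hg0 : g 0 < 0 := by simp only [hg, survivalProb_zero]; linarith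
  obtain ⟨k, hk, hgk⟩ := intermediate_value_Icc hA0 hcont.continuousOn ⟨hg0.le, hA.le⟩
  have hk0 : 0 < k := by
    refine lt_of_le_of_ne hk.1 fun h => ?_
    rw [← h] at hgk; linarith
  refine ⟨k, hk0, fun x hx => ⟨fun h => ?_, fun h => ?_⟩⟩
  · exact hgk ▸ hmono hx hk0.le h
  · exact hgk ▸ hmono.monotoneOn hk0.le hx h

/-- At the midpoint of two distinct boundaries the bond would be worth both at least E and less than
E. -/
lemma IsExerciseBoundary.unique {K K' : ℝ} (h : M.IsExerciseBoundary K)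
    (h' : M.IsExerciseBoundary K') : K = K' := by
  have key : ∀ K K', M.IsExerciseBoundary K → M.IsExerciseBoundary K' → K' ≤ K := by
    intro K K' h h'
    by_contra! hlt
    have hV : M.barrier M.T₁ < (K + K') / 2 := by linarith [h.1]
    have a1 := (h.2 _ hV).2 (by linarith)
    have a2 := (h'.2 _ hV).1 (by linarith)
    linarith
  exact le_antisymm (key _ _ h' h) (key _ _ h h')

lemma isExerciseBoundary_barrier_mul_exp (hσ : 0 < M.σ) (hb : 0 < M.b) {k : ℝ} (hk : 0 < k)
    (h : ∀ x, 0 ≤ x →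
      (x < k → M.recoveryExcess + M.lossAmount *
        survivalProb M.drift M.σ (M.T - M.T₁) x < 0) ∧
      (k ≤ x → 0 ≤ M.recoveryExcess + M.lossAmount *
        survivalProb M.drift M.σ (M.T - M.T₁) x)) :
    M.IsExerciseBoundary (M.barrier M.T₁ * Real.exp k) := by
  have hB := barrier_pos hb M.T₁
  refine ⟨le_mul_of_one_le_right hB.le (Real.one_le_exp hk.le), fun V hV => ?_⟩
  have hV0 : 0 < V := hB.trans hV
  have hx : 0 ≤ Real.log (V / M.barrier M.T₁) :=
    Real.log_nonneg ((one_le_div hB).2 hV.le)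
  have e := bond_sub_eq hσ hb hV0
  refine ⟨fun hlt => ?_, fun hle => ?_⟩
  · have := (h _ hx).1 (by
      rw [Real.log_lt_iff_lt_exp (by positivity), div_lt_iff₀ hB, mul_comm]; exact hlt)
    linarith
  · have := (h _ hx).2 (by
      rw [Real.le_log_iff_exp_le (by positivity), le_div_iff₀ hB, mul_comm]; exact hle)
    linarith

lemma IsExerciseBoundary.payoff_eq {K : ℝ} (hK : M.IsExerciseBoundary K) {V : ℝ}
    (hV : M.barrier M.T₁ < V) : M.payoff K V = max (M.bond V M.T₁ - M.E) 0 := by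
  rcases lt_or_ge V K with h | h
  · have := (hK.2 V hV).1 h
    rw [max_eq_right (by linarith), payoff, indicator_of_notMem (by simpa using h)]
    ring
  · have := (hK.2 V hV).2 h
    rw [max_eq_left (by linarith), payoff, indicator_of_mem (by simpa using h), bond, survival]
    simp only [Pi.one_apply]
    ring

/-! ### The solution as a Gaussian mean -/

/-- The terminal value in the logarithmic variable, extended by zero. -/
noncomputable def logPayoff (M : Model) (y : ℝ) : ℝ :=
  max (M.recoveryExcess + M.lossAmount *
    survivalProb M.drift M.σ (M.T - M.T₁) (max y 0)) 0

lemma continuous_logPayoff : Continuous M.logPayoff := by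
  have := continuous_survivalProb (κ := M.drift) (σ := M.σ) (θ := M.T - M.T₁)
  unfold logPayoff
  fun_prop

lemma abs_logPayoff_le (hR₁ : M.R < 1) (hE₁ : Real.exp (-M.r * (M.T - M.T₁)) * M.R < M.E) (y : ℝ) :
    |M.logPayoff y| ≤ M.lossAmount := by
  have h1 := recoveryExcess_neg hE₁
  have h2 := lossAmount_pos hR₁
  rw [logPayoff, abs_of_nonneg (le_max_right _ _)]
  refine max_le ?_ h2.le
  have := mul_le_of_le_one_right h2.le
    (survivalProb_le_one (κ := M.drift) (σ := M.σ) (θ := M.T - M.T₁) (max y 0))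
  linarith

lemma logPayoff_of_nonpos (hE₁ : Real.exp (-M.r * (M.T - M.T₁)) * M.R < M.E) {y : ℝ} (hy : y ≤ 0) :
    M.logPayoff y = 0 := by
  rw [logPayoff, max_eq_right hy, survivalProb_zero, mul_zero, add_zero,
    max_eq_right (recoveryExcess_neg hE₁).le]

/-- The positive-part form is visibly continuous, while this one can be integrated explicitly. Since
k > 0, the truncation at 0 is invisible where the payoff is nonzero. -/
lemma logPayoff_eq_indicator (hE₁ : Real.exp (-M.r * (M.T - M.T₁)) * M.R < M.E) {k : ℝ}
    (hk : 0 < k) (h : ∀ x, 0 ≤ x →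
      (x < k → M.recoveryExcess + M.lossAmount *
        survivalProb M.drift M.σ (M.T - M.T₁) x < 0) ∧
      (k ≤ x → 0 ≤ M.recoveryExcess + M.lossAmount *
        survivalProb M.drift M.σ (M.T - M.T₁) x)) :
    M.logPayoff = (Ici k).indicator fun y => M.recoveryExcess + M.lossAmount *
        survivalProb M.drift M.σ (M.T - M.T₁) y := by
  funext y
  rcases le_or_gt y 0 with hy | hy
  · rw [logPayoff_of_nonpos hE₁ hy, indicator_of_notMem]
    simpa using hy.trans_lt hk
  · rcases lt_or_ge y k with hyk | hyk
    · rw [indicator_of_notMem (by simpa using hyk), logPayoff, max_eq_left hy.le,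
        max_eq_right ((h y hy.le).1 hyk).le]
    · rw [indicator_of_mem (by simpa using hyk), logPayoff, max_eq_left hy.le,
        max_eq_left ((h y hy.le).2 hyk)]

/-- The mean of the terminal value over paths killed at the origin. -/
noncomputable def killedMean (M : Model) (x τ : ℝ) : ℝ :=
  heatMean M.drift M.σ M.logPayoff x τ -
    Real.exp (M.expo * x) * heatMean M.drift M.σ M.logPayoff (-x) τ

/-- The discounted mean of the terminal value over paths killed at the barrier. -/
noncomputable def killedPrice (M : Model) (V t : ℝ) : ℝ :=
  Real.exp (-M.r * (M.T₁ - t)) * M.killedMean (Real.log (V / M.barrier t)) (M.T₁ - t)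

lemma hasDerivAt_log_div_barrier (hb : 0 < M.b) {V : ℝ} (hV : 0 < V) (t : ℝ) :
    HasDerivAt (fun s => Real.log (V / M.barrier s)) (-M.a) t := by
  have hB := barrier_pos hb t
  have h1 : HasDerivAt M.barrier (M.a * M.barrier t) t := by
    have := ((((hasDerivAt_id t).const_sub M.T).const_mul (-M.a)).exp).const_mul M.b
    refine this.congr_deriv ?_
    simp only [barrier, id]
    ring
  refine (((hasDerivAt_const t V).div h1 hB.ne').log (div_pos hV hB).ne').congr_deriv ?_
  simp only [Pi.div_apply]
  field_simp
  ring

lemma continuousOn_log_div_barrier (hb : 0 < M.b) :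
    ContinuousOn (fun z : ℝ × ℝ => Real.log (z.1 / M.barrier z.2)) {z | 0 < z.1} := by
  have := M.continuous_barrier
  refine ContinuousOn.log (ContinuousOn.div (by fun_prop) (by fun_prop) fun z _ =>
    (barrier_pos hb z.2).ne') fun z (hz : 0 < z.1) => (div_pos hz (barrier_pos hb z.2)).ne'

/-- A solution of the heat equation with drift, in the variables of the model, solves the
Black-Scholes equation. -/
lemma exists_blackScholes_of_isDriftHeatSolution (hb : 0 < M.b) {U Ux Uxx : ℝ → ℝ → ℝ}
    (h : IsDriftHeatSolution M.drift M.σ U Ux Uxx) {P : ℝ → ℝ → ℝ}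
    (hP : ∀ V t, P V t =
      Real.exp (-M.r * (M.T₁ - t)) * U (Real.log (V / M.barrier t)) (M.T₁ - t)) :
    ∃ Pt PV PVV : ℝ → ℝ → ℝ,
      ContinuousOn (fun z : ℝ × ℝ => Pt z.1 z.2) M.region ∧
      ContinuousOn (fun z : ℝ × ℝ => PV z.1 z.2) M.region ∧
      ContinuousOn (fun z : ℝ × ℝ => PVV z.1 z.2) M.region ∧
      ∀ V t, (V, t) ∈ M.region →
        HasDerivWithinAt (fun s => P V s) (Pt V t) (Set.Icc 0 M.T₁) t ∧
        HasDerivAt (fun v => P v t) (PV V t) V ∧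
        HasDerivAt (fun v => PV v t) (PVV V t) V ∧
        Pt V t + 1 / 2 * M.σ ^ 2 * V ^ 2 * PVV V t + (M.r - M.q) * V * PV V t -
          M.r * P V t = 0 := by
  have hpos : ∀ z ∈ M.region, 0 < z.1 := fun z hz => (barrier_pos hb z.2).trans hz.2.2
  have hmaps : ContinuousOn (fun z : ℝ × ℝ => (Real.log (z.1 / M.barrier z.2), M.T₁ - z.2))
      M.region :=
    ((continuousOn_log_div_barrier hb).mono hpos).prodMk (by fun_prop)
  have hto : MapsTo (fun z : ℝ × ℝ => (Real.log (z.1 / M.barrier z.2), M.T₁ - z.2))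
      M.region {z | 0 < z.2} := fun z hz => sub_pos.2 hz.2.1
  have cU := h.cont.comp hmaps hto
  have cUx := h.cont_x.comp hmaps hto
  have cUxx := h.cont_xx.comp hmaps hto
  simp only [Function.comp_def] at cU cUx cUxx
  -- The chain rule has x_t = -a, τ_t = -1, x_V = 1/V. In P_t the derivative U_τ is replaced through
  -- the heat equation, so continuity of U, U_x, U_xx suffices.
  refine ⟨fun V t => Real.exp (-M.r * (M.T₁ - t)) *
      (M.r * U (Real.log (V / M.barrier t)) (M.T₁ - t) -
        M.a * Ux (Real.log (V / M.barrier t)) (M.T₁ - t) -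
        (M.σ ^ 2 / 2 * Uxx (Real.log (V / M.barrier t)) (M.T₁ - t) +
          M.drift * Ux (Real.log (V / M.barrier t)) (M.T₁ - t))),
    fun V t => Real.exp (-M.r * (M.T₁ - t)) *
      (Ux (Real.log (V / M.barrier t)) (M.T₁ - t) / V),
    fun V t => Real.exp (-M.r * (M.T₁ - t)) *
      ((Uxx (Real.log (V / M.barrier t)) (M.T₁ - t) -
        Ux (Real.log (V / M.barrier t)) (M.T₁ - t)) / V ^ 2), ?_, ?_, ?_, ?_⟩
  · exact ContinuousOn.mul (by fun_prop) (((cU.const_mul _).sub (cUx.const_mul _)).sub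
      ((cUxx.const_mul _).add (cUx.const_mul _)))
  · exact ContinuousOn.mul (by fun_prop) (cUx.div (by fun_prop) fun z hz => (hpos z hz).ne')
  · exact ContinuousOn.mul (by fun_prop)
      ((cUxx.sub cUx).div (by fun_prop) fun z hz => (pow_pos (hpos z hz) 2).ne')
  · rintro V t hz
    have hV : 0 < V := hpos _ hz
    have hτ : 0 < M.T₁ - t := sub_pos.2 hz.2.1
    have hB := barrier_pos hb t
    have hlog : HasDerivAt (fun v => Real.log (v / M.barrier t)) (1 / V) V := by
      refine (((hasDerivAt_id V).div_const _).log (div_pos hV hB).ne').congr_deriv ?_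
      simp only [id]
      field_simp
    refine ⟨HasDerivAt.hasDerivWithinAt ?_, ?_, ?_, ?_⟩
    · have h1 : HasDerivAt (fun s => M.T₁ - s) (-1) t := (hasDerivAt_id t).const_sub _
      have h2 := h.curve _ _ _ _ _ (hasDerivAt_log_div_barrier hb hV t) h1 hτ
      have h3 := (h1.const_mul (-M.r)).exp
      simp only [hP]
      refine (h3.mul h2).congr_deriv ?_
      ring
    · have h2 := h.curve _ _ _ _ _ hlog (hasDerivAt_const V (M.T₁ - t)) hτ
      simp only [hP]
      refine (h2.const_mul _).congr_deriv ?_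
      ring
    · have h2 := HasDerivAt.comp V (h.deriv_x _ _ hτ) hlog
      refine ((h2.div (hasDerivAt_id V) hV.ne').const_mul _).congr_deriv ?_
      simp only [Function.comp, id]
      field_simp
    · rw [hP]
      simp only [drift]
      field_simp
      ring

lemma isDriftHeatSolution_killedMean (hσ : 0 < M.σ) (hR₁ : M.R < 1)
    (hE₁ : Real.exp (-M.r * (M.T - M.T₁)) * M.R < M.E) :
    ∃ Ux Uxx, IsDriftHeatSolution M.drift M.σ M.killedMean Ux Uxx :=
  ⟨_, _, (isDriftHeatSolution_heatMean continuous_logPayoff (abs_logPayoff_le hR₁ hE₁)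
    hσ).sub_reflect (by rw [expo_eq hσ]; field_simp)⟩

lemma continuous_killedMean (hR₁ : M.R < 1)
    (hE₁ : Real.exp (-M.r * (M.T - M.T₁)) * M.R < M.E) :
    Continuous fun z : ℝ × ℝ => M.killedMean z.1 z.2 := by
  have h := continuous_heatMean (κ := M.drift) (σ := M.σ) continuous_logPayoff
    (abs_logPayoff_le hR₁ hE₁)
  have h' := h.comp (g := fun z : ℝ × ℝ => heatMean M.drift M.σ M.logPayoff z.1 z.2)
    (f := fun z : ℝ × ℝ => (-z.1, z.2)) (by fun_prop)
  exact h.sub (Continuous.mul (by fun_prop) h')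

/-- Since V/V_b(t) ≥ 1, a real exponent of either sign may be raised to the integer ⌈|β|⌉, and the
barrier is bounded below on the time interval. This gives the reflected term polynomial growth. -/
lemma exp_mul_log_div_barrier_le (hb : 0 < M.b) (hT : M.T₁ < M.T) {z : ℝ × ℝ}
    (hz : z ∈ M.closedRegion) (β : ℝ) :
    Real.exp (β * Real.log (z.1 / M.barrier z.2)) ≤
      (Real.exp (|M.a| * M.T) / M.b) ^ ⌈|β|⌉₊ * z.1 ^ ⌈|β|⌉₊ := by
  have hB := barrier_pos hb z.2
  have hV : 0 < z.1 := hB.trans_le hz.2.2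
  have hx : 0 ≤ Real.log (z.1 / M.barrier z.2) := Real.log_nonneg ((one_le_div hB).2 hz.2.2)
  have hinv : (M.barrier z.2)⁻¹ ≤ Real.exp (|M.a| * M.T) / M.b := by
    rw [barrier, mul_inv, ← Real.exp_neg, mul_comm, ← div_eq_mul_inv]
    gcongr
    have h1 : 0 ≤ M.T - z.2 := by linarith [hz.2.1]
    calc -(-M.a * (M.T - z.2)) = M.a * (M.T - z.2) := by ring
      _ ≤ |M.a| * (M.T - z.2) := by gcongr; exact le_abs_self _
      _ ≤ |M.a| * M.T := by gcongr; linarith [hz.1]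
  calc Real.exp (β * Real.log (z.1 / M.barrier z.2))
      ≤ Real.exp (⌈|β|⌉₊ * Real.log (z.1 / M.barrier z.2)) := by
        gcongr; exact (le_abs_self β).trans (Nat.le_ceil _)
    _ = (z.1 / M.barrier z.2) ^ ⌈|β|⌉₊ := by
        rw [Real.exp_nat_mul, Real.exp_log (div_pos hV hB)]
    _ ≤ (Real.exp (|M.a| * M.T) / M.b * z.1) ^ ⌈|β|⌉₊ := by
        rw [div_eq_inv_mul]; gcongr
    _ = _ := mul_pow _ _ _

/-- At x = 0 the two means coincide with weight 1 and cancel; at τ = 0 the reflected mean reads the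
payoff at -x ≤ 0, where it vanishes. -/
lemma isCallSolution_killedPrice (hσ : 0 < M.σ) (hb : 0 < M.b) (hR₁ : M.R < 1)
    (hT : M.T₁ < M.T) (hE₁ : Real.exp (-M.r * (M.T - M.T₁)) * M.R < M.E) {K : ℝ}
    (hK : M.IsExerciseBoundary K) : M.IsCallSolution K M.killedPrice where
  continuousOn := by
    have hpos : ∀ z ∈ M.closedRegion, 0 < z.1 := fun z hz =>
      (barrier_pos hb z.2).trans_le hz.2.2
    have h := (continuous_killedMean hR₁ hE₁).comp_continuousOn
      (((continuousOn_log_div_barrier hb).mono hpos).prodMk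
        (by fun_prop : ContinuousOn (fun z : ℝ × ℝ => M.T₁ - z.2) M.closedRegion))
    exact ContinuousOn.mul (by fun_prop) h
  growth := by
    have hc := lossAmount_pos hR₁
    set D := Real.exp (|M.a| * M.T) / M.b with hD
    have hD0 : 0 < D := by positivity
    set n := ⌈|M.expo|⌉₊
    refine ⟨Real.exp (|M.r| * M.T₁) * (M.lossAmount * (1 + D ^ n)), n, fun z hz => ?_⟩
    have hV : 0 < z.1 := (barrier_pos hb z.2).trans_le hz.2.2
    set x := Real.log (z.1 / M.barrier z.2) with hx
    have h1 := abs_heatMean_le (κ := M.drift) (σ := M.σ) (abs_logPayoff_le hR₁ hE₁) x (M.T₁ - z.2)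
    have h2 := abs_heatMean_le (κ := M.drift) (σ := M.σ) (abs_logPayoff_le hR₁ hE₁)
      (-x) (M.T₁ - z.2)
    have h3 := exp_mul_log_div_barrier_le hb hT hz M.expo
    have h4 : |M.killedMean x (M.T₁ - z.2)| ≤ M.lossAmount * (1 + D ^ n) * (1 + z.1 ^ n) := by
      calc _ ≤ M.lossAmount + D ^ n * z.1 ^ n * M.lossAmount := by
            refine (abs_sub _ _).trans (add_le_add h1 ?_)
            rw [abs_mul, Real.abs_exp]
            gcongr
        _ ≤ _ := by
            have : 0 ≤ M.lossAmount * (D ^ n + z.1 ^ n) := by positivity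
            linarith
    have h5 : Real.exp (-M.r * (M.T₁ - z.2)) ≤ Real.exp (|M.r| * M.T₁) := by
      refine Real.exp_le_exp.2 ?_
      have h6 : 0 ≤ M.T₁ - z.2 := by linarith [hz.2.1]
      calc -M.r * (M.T₁ - z.2) ≤ |M.r| * (M.T₁ - z.2) := by gcongr; exact neg_le_abs _
        _ ≤ _ := by gcongr; linarith [hz.1]
    rw [killedPrice, ← hx, abs_mul, Real.abs_exp, mul_assoc (Real.exp (|M.r| * M.T₁))]
    gcongr
  equation := by
    obtain ⟨Ux, Uxx, h⟩ := isDriftHeatSolution_killedMean hσ hR₁ hE₁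
    exact exists_blackScholes_of_isDriftHeatSolution hb h fun _ _ => rfl
  boundary t _ _ := by
    rw [killedPrice, div_self (barrier_pos hb t).ne', Real.log_one, killedMean]
    simp
  terminal V hV := by
    have hB := barrier_pos hb M.T₁
    have hx : 0 ≤ Real.log (V / M.barrier M.T₁) := Real.log_nonneg ((one_le_div hB).2 hV.le)
    rw [hK.payoff_eq hV, bond_sub_eq hσ hb (hB.trans hV), killedPrice, killedMean, sub_self,
      heatMean_zero, heatMean_zero, logPayoff_of_nonpos hE₁ (neg_nonpos.2 hx), logPayoff,
      max_eq_left hx]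
    simp

/-! ### The closed form -/

lemma killedPrice_eq_callPrice (hσ : 0 < M.σ) (hb : 0 < M.b) (hT : M.T₁ < M.T)
    (hE₁ : Real.exp (-M.r * (M.T - M.T₁)) * M.R < M.E) {k : ℝ} (hk : 0 < k)
    (h : ∀ x, 0 ≤ x →
      (x < k → M.recoveryExcess + M.lossAmount *
        survivalProb M.drift M.σ (M.T - M.T₁) x < 0) ∧
      (k ≤ x → 0 ≤ M.recoveryExcess + M.lossAmount *
        survivalProb M.drift M.σ (M.T - M.T₁) x))
    {V t : ℝ} (hV : 0 < V) (ht : t < M.T₁) :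
    M.killedPrice V t = M.callPrice (M.barrier M.T₁ * Real.exp k) V t := by
  have hτ : 0 < M.T₁ - t := by linarith
  have hθ : 0 < M.T - M.T₁ := by linarith
  have hB := barrier_pos hb t
  have hB₁ := barrier_pos hb M.T₁
  set x := Real.log (V / M.barrier t) with hx
  have hlogV : Real.log V = x + Real.log (M.barrier t) := by
    rw [hx, Real.log_div hV.ne' hB.ne']; ring
  have hlogB : ∀ s, Real.log (M.barrier s) = Real.log M.b - M.a * (M.T - s) := fun s => by
    rw [barrier, Real.log_mul hb.ne' (Real.exp_pos _).ne', Real.log_exp]; ring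
  have hlogK : Real.log (M.barrier M.T₁ * Real.exp k) = Real.log (M.barrier M.T₁) + k := by
    rw [Real.log_mul hB₁.ne' (Real.exp_pos _).ne', Real.log_exp]
  have hKpos : 0 < M.barrier M.T₁ * Real.exp k := by positivity
  have hsum : M.T₁ - t + (M.T - M.T₁) = M.T - t := by ring
  have eb2 : M.b2 (M.barrier M.T₁ * Real.exp k) V t =
      (x + M.drift * (M.T₁ - t) - k) / (M.σ * Real.sqrt (M.T₁ - t)) := by
    rw [b2, Real.log_div hV.ne' hKpos.ne', hlogK, hlogV, hlogB, hlogB, drift]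
    congr 1
    ring
  have elog : Real.log (M.barrier M.T₁ / (M.barrier M.T₁ * Real.exp k) * (M.barrier t / V)) =
      -x - k := by
    rw [Real.log_mul (by positivity) (by positivity), log_barrier_div V t, ← hx,
      Real.log_div hB₁.ne' hKpos.ne', hlogK]
    ring
  have eb2' : M.b2Tilde (M.barrier M.T₁ * Real.exp k) V t =
      (-x + M.drift * (M.T₁ - t) - k) / (M.σ * Real.sqrt (M.T₁ - t)) := by
    rw [b2Tilde, elog]
    congr 1
    ring
  have eb5 : -M.b5 (M.barrier M.T₁ * Real.exp k) V t =
      (-x - M.drift * (M.T₁ - t) - k) / (M.σ * Real.sqrt (M.T₁ - t)) := by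
    rw [b5, elog, neg_neg]
    congr 1
    ring
  have eb5' : -M.b5Tilde (M.barrier M.T₁ * Real.exp k) V t =
      (x - M.drift * (M.T₁ - t) - k) / (M.σ * Real.sqrt (M.T₁ - t)) := by
    rw [b5Tilde, neg_neg, Real.log_div (by positivity) (by positivity),
      Real.log_mul hV.ne' (Real.exp_pos _).ne', Real.log_mul hKpos.ne' (Real.exp_pos _).ne',
      Real.log_exp, Real.log_exp, hlogK, hlogV, hlogB, hlogB]
    congr 1
    ring
  have ed : M.d V t = (x + M.drift * (M.T - t)) / (M.σ * Real.sqrt (M.T - t)) := rfl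
  have ed' : M.dTilde V t = (-x + M.drift * (M.T - t)) / (M.σ * Real.sqrt (M.T - t)) := by
    rw [dTilde, log_barrier_div]
  have ec : M.corr t = Real.sqrt ((M.T₁ - t) / (M.T - t)) := rfl
  have hdisc : Real.exp (-M.r * (M.T - t)) =
      Real.exp (-M.r * (M.T₁ - t)) * Real.exp (-M.r * (M.T - M.T₁)) := by
    rw [← Real.exp_add]; congr 1; ring
  -- The reflected mean's own reflected term carries both weights, whose product is 1; hence N₂(d,
  -- -b₅; -ρ) appears with a plus sign and without a power of V/V_b(t).
  have hcancel : Real.exp (M.expo * x) * Real.exp (M.expo * -x) = 1 := by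
    rw [← Real.exp_add]; simp
  rw [killedPrice, ← hx, killedMean, logPayoff_eq_indicator hE₁ hk h,
    heatMean_indicator_survivalProb hσ hτ hθ, heatMean_indicator_survivalProb hσ hτ hθ, hsum,
    ← expo_eq hσ, neg_neg, callPrice, eb2, eb2', eb5, eb5', ed, ed', ec,
    div_barrier_rpow_expo hb hV, ← hx, hdisc, recoveryExcess, lossAmount]
  linear_combination (Real.exp (-M.r * (M.T₁ - t)) * ((1 - M.R) *
    Real.exp (-M.r * (M.T - M.T₁))) *
      binormalCDF ((x + M.drift * (M.T - t)) / (M.σ * Real.sqrt (M.T - t)))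
        ((-x - M.drift * (M.T₁ - t) - k) / (M.σ * Real.sqrt (M.T₁ - t)))
        (-Real.sqrt ((M.T₁ - t) / (M.T - t)))) * hcancel

end Model

end CreditBond

theorem theorem5 (M : CreditBond.Model)
    (hσ : 0 < M.σ) (hb : 0 < M.b) (hR₀ : 0 ≤ M.R) (hR₁ : M.R < 1)
    (hT₁ : 0 < M.T₁) (hT : M.T₁ < M.T)
    (hE₁ : Real.exp (-M.r * (M.T - M.T₁)) * M.R < M.E)
    (hE₂ : M.E < Real.exp (-M.r * (M.T - M.T₁))) :
    (∃! K, M.IsExerciseBoundary K) ∧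
    ∀ K, M.IsExerciseBoundary K →
      (∀ V, M.barrier M.T₁ < V → M.payoff K V = max (M.bond V M.T₁ - M.E) 0) ∧
      (∃ P, M.IsCallSolution K P) ∧
      (∀ P, M.IsCallSolution K P →
        ∀ t, 0 ≤ t → t < M.T₁ → ∀ V, M.barrier t ≤ V → P V t = M.callPrice K V t) := by
  obtain ⟨k, hk, h⟩ := CreditBond.Model.exists_logBoundary hσ hR₁ hT hE₁ hE₂
  have hK₀ := CreditBond.Model.isExerciseBoundary_barrier_mul_exp hσ hb hk h
  refine ⟨⟨_, hK₀, fun K hK => hK.unique hK₀⟩, fun K hK => ⟨fun V hV => hK.payoff_eq hV, ?_, ?_⟩⟩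
  · exact ⟨_, CreditBond.Model.isCallSolution_killedPrice hσ hb hR₁ hT hE₁ hK⟩
  · intro P hP t ht htT V hV
    have hsol := CreditBond.Model.isCallSolution_killedPrice hσ hb hR₁ hT hE₁ hK
    have hz : (V, t) ∈ M.closedRegion := ⟨ht, htT.le, hV⟩
    rw [hK.unique hK₀, ← CreditBond.Model.killedPrice_eq_callPrice hσ hb hT hE₁ hk h
      ((CreditBond.Model.barrier_pos hb t).trans_le hV) htT]
    exact hP.unique hb hσ hT₁ hsol hz
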